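/- Let $\mathbb T=\{z\in\mathbb C:|z|=1\}$ and let $\mathcal P(\mathbb T)$ be the set of Borel probability measures on $\mathbb T$ with the topology of weak convergence of measures. For a finite Borel measure $\mu$ on $\mathbb T$ and $n\in\mathbb Z$ put $\widehat\mu(n)=\int_{\mathbb T}z^n\,d\mu(z)$. Let $T$ be an invertible, bimeasurable, measure-preserving transformation of a probability space $(X,\mathcal B,m)$. It is \emph{weakly mixing} if for every $f\in L^2(X,\mathcal B,m)$ with $\int_X f\,dm=0$ the spectral measure of $f$, i.e. the finite positive Borel measure $\sigma$ on $\mathbb T$ with $\widehat\sigma(j)=\int_X (f\circ T^j)\,\overline f\,dm$ for all $j\in\mathbb Z$, has no atoms. A sequence of integers $(n_k)_{k\ge0}$ is a \emph{rigidity sequence} if there is such a weakly mixing system $(X,\mathcal B,m;T)$, nontrivial in the sense that $0<m(A)<1$ for some $A\in\mathcal B$, with $m(T^{-n_k}A\,\triangle\,A)\to0$ as $k\to\infty$ for every $A\in\mathcal B$. \textbf{Theorem.} Let $(n_k)_{k\ge 0}$ be a sequence of integers. For $\varepsilon>0$ put $$\mathcal R_\varepsilon=\Bigl\{\mu\in\mathcal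 P(\mathbb T):\limsup_{k\to\infty}|\widehat\mu(n_k)-1|<\varepsilon\Bigr\},\qquad \Gamma_\varepsilon=\Bigl\{z\in\mathbb T:\limsup_{k\to\infty}|z^{n_k}-1|<\varepsilon\Bigr\}.$$ (1) $(n_k)$ is a rigidity sequence if and only if $\mathcal R_\varepsilon$ is dense in $\mathcal P(\mathbb T)$ for every $\varepsilon>0$. (2) If $\Gamma_\varepsilon$ is dense in $\mathbb T$ for every $\varepsilon>0$, then $(n_k)$ is a rigidity sequence. -/

import Mathlib

open MeasureTheory Filter Topology

namespace RigiditySeq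

/-- The unit circle carries its Borel σ-algebra. -/
noncomputable instance instMeasurableSpaceCircle : MeasurableSpace Circle := borel Circle

instance instBorelSpaceCircle : BorelSpace Circle := ⟨rfl⟩

/-- The `n`-th Fourier coefficient `∫ z ^ n dμ(z)` of a measure `μ` on the unit circle. -/
noncomputable def fourierCoefficient (μ : Measure Circle) (n : ℤ) : ℂ :=
  ∫ z : Circle, ((z ^ n : Circle) : ℂ) ∂μ

/-- The set of probability measures on the circle with `limsup |μ̂(n_k) - 1| < ε`. -/
def almostRigidMeasures (n : ℕ → ℤ) (ε : ℝ) : Set (ProbabilityMeasure Circle) :=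
  {μ | limsup (fun k => ‖fourierCoefficient (μ : Measure Circle) (n k) - 1‖) atTop < ε}

/-- The set of points of the circle with `limsup |z ^ {n_k} - 1| < ε`. -/
def almostRigidPoints (n : ℕ → ℤ) (ε : ℝ) : Set Circle :=
  {z | limsup (fun k => ‖((z ^ n k : Circle) : ℂ) - 1‖) atTop < ε}

section Systems

variable {X : Type*} [MeasurableSpace X]

/-- The iterate `T ^ j`, `j ∈ ℤ`, of an invertible bimeasurable transformation. -/
def iter (T : X ≃ᵐ X) (j : ℤ) : X → X := (T.toEquiv ^ j : Equiv.Perm X)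

/-- `σ` is the spectral measure of `f` for the Koopman operator `U f = f ∘ T` on `L²(m)`:
the finite Borel measure on the circle whose `j`-th Fourier coefficient is `⟨U ^ j f, f⟩`. -/
def IsSpectralMeasure (m : Measure X) (T : X ≃ᵐ X) (f : X → ℂ) (σ : Measure Circle) : Prop :=
  IsFiniteMeasure σ ∧
    ∀ j : ℤ, fourierCoefficient σ j = ∫ x, f (iter T j x) * (starRingEnd ℂ) (f x) ∂m

/-- The measure-preserving transformation `T` is weakly mixing: the spectral measure of every
`f ∈ L²(m)` with `∫ f dm = 0` is continuous, that is, atomless. -/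
def IsWeaklyMixing (m : Measure X) (T : X ≃ᵐ X) : Prop :=
  ∀ f : X → ℂ, MemLp f 2 m → ∫ x, f x ∂m = 0 →
    ∃ σ : Measure Circle, IsSpectralMeasure m T f σ ∧ ∀ z : Circle, σ {z} = 0

/-- The sequence `(n_k)` is rigid for `(X, m; T)`: `m (T ^ {-n_k} A ∆ A) → 0` for every
measurable set `A`. -/
def IsRigidFor (m : Measure X) (T : X ≃ᵐ X) (n : ℕ → ℤ) : Prop :=
  ∀ A : Set X, MeasurableSet A →
    Tendsto (fun k => m (symmDiff (iter T (n k) ⁻¹' A) A)) atTop (𝓝 0)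

end Systems

/-- `(n_k)` is a rigidity sequence: it is rigid for some weakly mixing invertible
measure-preserving system `(X, m; T)` on a probability space. The space is required to be
nontrivial (some measurable set has measure different from `0` and `1`), because every sequence
is rigid for a trivial system. -/
def IsRigiditySequence (n : ℕ → ℤ) : Prop :=
  ∃ (X : Type) (_ : MeasurableSpace X) (m : Measure X) (T : X ≃ᵐ X),
    IsProbabilityMeasure m ∧ (∃ A : Set X, MeasurableSet A ∧ m A ≠ 0 ∧ m A ≠ 1) ∧
      MeasurePreserving T m m ∧ IsWeaklyMixing m T ∧ IsRigidFor m T n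

end RigiditySeq

/-! Everything passes through one spectral criterion: a rigidity sequence is one for which some
atomless probability measure `σ` on the circle has `σ̂(n_k) → 1`.

From a system to `σ`: normalise the spectral measure of `1_A - m(A)`. Weak mixing removes atoms and
rigidity gives the limit (`exists_atomless_of_isRigiditySequence`). From `σ` to a system: take the
stationary Gaussian process `(X_j)` with spectral measure `σ`, realised as the law of `(exp(i X_j))`
on the compact space `ℤ → Circle`. The correlations of characters there are `exp(-½ ∫ |P|² dσ)`;
Wiener's lemma gives weak mixing, and `z ^ n_k → 1` in `L²(σ)` gives rigidity.

If `σ` exists, the almost rigid measures are dense: measures rigid along `n` are stable under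
mixtures, convolution, reflection and conditioning, so the points whose Dirac masses are limits of
such measures form a subgroup containing the support of `σ`. An infinite subgroup of the circle is
dense, and mixtures of Dirac masses are dense (`dense_almostRigidMeasures_of_atomless`).

If the almost rigid measures are dense, `σ` is built by successive approximation (`exists_average`,
`exists_atomless_rigid`). A measure with error at most `ε` is replaced by an average of many nearby
measures with smaller eventual error. Their uncontrolled windows of indices are disjoint, so the
error never exceeds `2ε` in the transition. Atoms are made small at every stage, and compactness
provides `σ`.

Part (2) reduces to (1), since almost rigid measures are convex and contain the Dirac masses at
almost rigid points. -/

namespace RigiditySeq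

open scoped NNReal ENNReal

/-! ### Convex combinations of probability measures and weak convergence -/

section Mix

variable {Ω ι : Type*} [MeasurableSpace Ω] [Fintype ι]

/-- The convex combination `∑ i, a i • μ i` of probability measures. -/
noncomputable def mix (a : ι → ℝ≥0) (ha : ∑ i, a i = 1) (μ : ι → ProbabilityMeasure Ω) :
    ProbabilityMeasure Ω :=
  ⟨∑ i, a i • (μ i : Measure Ω), ⟨by
    simp only [Measure.coe_finsetSum, Finset.sum_apply, Measure.smul_apply, measure_univ]
    simp only [ENNReal.smul_def, smul_eq_mul, mul_one]
    exact_mod_cast ha⟩⟩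

lemma toMeasure_mix (a : ι → ℝ≥0) (ha : ∑ i, a i = 1) (μ : ι → ProbabilityMeasure Ω) :
    (mix a ha μ : Measure Ω) = ∑ i, a i • (μ i : Measure Ω) := rfl

lemma integral_mix {E : Type*} [NormedAddCommGroup E] [NormedSpace ℝ E]
    (a : ι → ℝ≥0) (ha : ∑ i, a i = 1) (μ : ι → ProbabilityMeasure Ω)
    {f : Ω → E} (hf : ∀ i, Integrable f (μ i : Measure Ω)) :
    ∫ x, f x ∂(mix a ha μ : Measure Ω) = ∑ i, (a i : ℝ) • ∫ x, f x ∂(μ i : Measure Ω) := by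
  rw [toMeasure_mix, integral_finsetSum_measure fun i _ => (hf i).smul_measure_nnreal]
  simp [integral_smul_nnreal_measure, NNReal.smul_def]

lemma mix_const (a : ι → ℝ≥0) (ha : ∑ i, a i = 1) (μ : ProbabilityMeasure Ω) :
    mix a ha (fun _ => μ) = μ := by
  apply Subtype.ext
  change ∑ i, a i • (μ : Measure Ω) = (μ : Measure Ω)
  rw [← Finset.sum_smul, ha, one_smul]

/-- A simple map pushes every probability measure to a finite combination of Dirac masses. -/
lemma map_simpleFunc_eq_mix {Y : Type*} [MeasurableSpace Y] (ν : ProbabilityMeasure Y)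
    (s : SimpleFunc Y Ω) : ∃ (a : s.range → ℝ≥0) (ha : ∑ i, a i = 1),
      ν.map s.measurable.aemeasurable = mix a ha fun i => diracProba (i : Ω) := by
  have hkey : ((ν : Measure Y).map s) = ∑ i : s.range, (ν (s ⁻¹' {(i : Ω)})) •
      Measure.dirac (i : Ω) := by
    ext A hA
    rw [Measure.map_apply s.measurable hA]
    have : s ⁻¹' A = ⋃ i : s.range, (s ⁻¹' {(i : Ω)} ∩ s ⁻¹' A) := by
      ext y
      simp
    rw [this, measure_iUnion]
    · rw [tsum_fintype, Measure.coe_finsetSum, Finset.sum_apply]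
      refine Finset.sum_congr rfl fun i _ => ?_
      rw [Measure.smul_apply, Measure.dirac_apply' _ hA]
      by_cases hi : (i : Ω) ∈ A
      · have : s ⁻¹' {(i : Ω)} ∩ s ⁻¹' A = s ⁻¹' {(i : Ω)} := by
          ext y; simp only [Set.mem_inter_iff, Set.mem_preimage, Set.mem_singleton_iff]
          exact ⟨fun h => h.1, fun h => ⟨h, h ▸ hi⟩⟩
        rw [this]
        simp [hi, ENNReal.smul_def]
      · have : s ⁻¹' {(i : Ω)} ∩ s ⁻¹' A = ∅ := by
          ext y; simp only [Set.mem_inter_iff, Set.mem_preimage, Set.mem_singleton_iff]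
          exact ⟨fun h => hi (h.1 ▸ h.2), fun h => h.elim⟩
        rw [this]
        simp [hi]
    · intro i j hij
      refine Set.disjoint_left.2 fun y hy hy' => hij (Subtype.ext ?_)
      exact hy.1.symm.trans hy'.1
    · exact fun i => (s.measurableSet_preimage _).inter (s.measurableSet_preimage _)
  have hsum : ∑ i : s.range, ν (s ⁻¹' {(i : Ω)}) = 1 := by
    have h1 : ((ν : Measure Y).map s) Set.univ = 1 := by
      rw [Measure.map_apply s.measurable .univ]; simp
    rw [hkey] at h1
    simp only [Measure.coe_finsetSum, Finset.sum_apply, Measure.smul_apply, measure_univ,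
      ENNReal.smul_def, smul_eq_mul, mul_one] at h1
    exact_mod_cast h1
  exact ⟨_, hsum, Subtype.ext hkey⟩

variable [TopologicalSpace Ω] [CompactSpace Ω] [OpensMeasurableSpace Ω]

lemma integrable_of_continuous {E : Type*} [NormedAddCommGroup E]
    [SecondCountableTopologyEither Ω E] {f : Ω → E} (hf : Continuous f)
    (μ : Measure Ω) [IsFiniteMeasure μ] : Integrable f μ := by
  refine (integrableOn_univ (μ := μ)).1 ?_
  obtain ⟨C, hC⟩ := (isCompact_range hf).isBounded.exists_norm_le
  exact (Integrable.of_bound (hf.aestronglyMeasurable) C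
    (ae_of_all _ fun x => hC _ ⟨x, rfl⟩)).integrableOn

lemma continuous_integral_complex {f : Ω → ℂ} (hf : Continuous f) :
    Continuous fun μ : ProbabilityMeasure Ω => ∫ x, f x ∂(μ : Measure Ω) := by
  rw [continuous_iff_continuousAt]
  intro μ
  exact (ProbabilityMeasure.tendsto_iff_forall_integral_rclike_tendsto ℂ).1 tendsto_id
    (BoundedContinuousFunction.mkOfCompact ⟨f, hf⟩)

lemma tendsto_probabilityMeasure_iff {γ : Type*} {F : Filter γ}
    {μs : γ → ProbabilityMeasure Ω} {μ : ProbabilityMeasure Ω} :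
    Tendsto μs F (𝓝 μ) ↔ ∀ f : Ω → ℝ, Continuous f →
      Tendsto (fun i => ∫ x, f x ∂(μs i : Measure Ω)) F (𝓝 (∫ x, f x ∂(μ : Measure Ω))) := by
  rw [ProbabilityMeasure.tendsto_iff_forall_integral_tendsto]
  exact ⟨fun h f hf => h (BoundedContinuousFunction.mkOfCompact ⟨f, hf⟩),
    fun h f => h f f.continuous⟩

lemma continuous_mix (a : ι → ℝ≥0) (ha : ∑ i, a i = 1) :
    Continuous fun μ : ι → ProbabilityMeasure Ω => mix a ha μ := by
  rw [continuous_iff_continuousAt]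
  intro μ
  refine tendsto_probabilityMeasure_iff.2 fun f hf => ?_
  simp_rw [integral_mix a ha _ fun i => integrable_of_continuous hf _]
  refine tendsto_finsetSum _ fun i _ => Tendsto.const_smul ?_ _
  exact tendsto_probabilityMeasure_iff.1 ((continuous_apply i).tendsto μ) f hf

/-- The closure of a set of measures stable under convex combinations is stable under convex
combinations. -/
lemma mix_mem_closure {C : Set (ProbabilityMeasure Ω)} (a : ι → ℝ≥0) (ha : ∑ i, a i = 1)
    (hC : ∀ μ : ι → ProbabilityMeasure Ω, (∀ i, μ i ∈ C) → mix a ha μ ∈ C)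
    (μ : ι → ProbabilityMeasure Ω) (hμ : ∀ i, μ i ∈ closure C) : mix a ha μ ∈ closure C := by
  refine map_mem_closure (s := Set.univ.pi fun _ => C) (continuous_mix a ha) ?_
    (fun ν hν => hC ν fun i => hν i trivial)
  rw [closure_pi_set]
  exact fun i _ => hμ i

end Mix

/-! ### Weak density of finitely supported measures -/

section Approximation

variable {Ω : Type*} [MeasurableSpace Ω] [MetricSpace Ω] [CompactSpace Ω] [BorelSpace Ω]

/-- Images of a fixed measure under pointwise convergent maps converge weakly. -/
lemma tendsto_map_of_pointwise {Y : Type*} [MeasurableSpace Y] (ν : ProbabilityMeasure Y)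
    {s : ℕ → Y → Ω} {t : Y → Ω} (hs : ∀ i, Measurable (s i)) (ht : Measurable t)
    (hst : ∀ y, Tendsto (fun i => s i y) atTop (𝓝 (t y))) :
    Tendsto (fun i => ν.map (hs i).aemeasurable) atTop (𝓝 (ν.map ht.aemeasurable)) := by
  refine tendsto_probabilityMeasure_iff.2 fun f hf => ?_
  simp only [ProbabilityMeasure.toMeasure_map]
  simp_rw [integral_map (hs _).aemeasurable hf.aestronglyMeasurable,
    integral_map ht.aemeasurable hf.aestronglyMeasurable]
  obtain ⟨C, hC⟩ := (isCompact_range hf).isBounded.exists_norm_le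
  exact tendsto_integral_of_dominated_convergence (fun _ => C)
    (fun i => (hf.measurable.comp (hs i)).aestronglyMeasurable) (integrable_const _)
    (fun i => ae_of_all _ fun y => hC _ ⟨_, rfl⟩)
    (ae_of_all _ fun y => (hf.tendsto _).comp (hst y))

/-- Finite combinations of Dirac masses at points of a dense set are weakly dense. -/
lemma mem_closure_mix_diracProba {S : Set Ω} (hS : Dense S) (μ : ProbabilityMeasure Ω) :
    μ ∈ closure {ν : ProbabilityMeasure Ω | ∃ (F : Finset Ω) (a : F → ℝ≥0) (ha : ∑ i, a i = 1),
      (∀ z ∈ F, z ∈ S) ∧ ν = mix a ha fun i => diracProba (i : Ω)} := by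
  have : Nonempty Ω := μ.nonempty
  obtain ⟨z₀, hz₀⟩ := hS.nonempty
  -- Simple functions with values in `S` converge pointwise to the identity, so the images of `μ`
  -- under them are finitely supported in `S` and converge weakly to `μ`.
  let s : ℕ → SimpleFunc Ω Ω := SimpleFunc.approxOn id measurable_id S z₀ hz₀
  have h := tendsto_map_of_pointwise μ (s := fun i => s i) (fun i => (s i).measurable)
    measurable_id (fun y => SimpleFunc.tendsto_approxOn measurable_id hz₀ (by simp [hS.closure_eq]))
  have hid : μ.map measurable_id.aemeasurable = μ := Subtype.ext Measure.map_id
  rw [hid] at h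
  refine mem_closure_of_tendsto h (Eventually.of_forall fun i => ?_)
  obtain ⟨a, ha, hm⟩ := map_simpleFunc_eq_mix μ (s i)
  refine ⟨(s i).range, a, ha, fun z hz => ?_, hm⟩
  obtain ⟨y, rfl⟩ := SimpleFunc.mem_range.1 hz
  exact SimpleFunc.approxOn_mem measurable_id hz₀ i y

/-- A set of measures stable under convex combinations and containing many Dirac masses is
dense. -/
lemma dense_of_mix_mem {C : Set (ProbabilityMeasure Ω)}
    (hC : ∀ (F : Finset Ω) (a : F → ℝ≥0) (ha : ∑ i, a i = 1) (μ : F → ProbabilityMeasure Ω),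
      (∀ i, μ i ∈ C) → mix a ha μ ∈ C)
    (hd : Dense {z : Ω | diracProba z ∈ C}) : Dense C := by
  intro μ
  refine closure_mono ?_ (mem_closure_mix_diracProba hd μ)
  rintro _ ⟨F, a, ha, hF, rfl⟩
  exact hC F a ha _ fun i => hF i i.2

end Approximation

/-! ### Fourier coefficients and the convexity of almost rigid measures -/

lemma continuous_circle_coe : Continuous fun z : Circle => (z : ℂ) := continuous_induced_dom

lemma continuous_coe_zpow (j : ℤ) : Continuous fun z : Circle => ((z ^ j : Circle) : ℂ) :=
  continuous_circle_coe.comp (continuous_zpow j)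

lemma continuous_fourierCoefficient (j : ℤ) :
    Continuous fun μ : ProbabilityMeasure Circle => fourierCoefficient (μ : Measure Circle) j :=
  continuous_integral_complex (continuous_coe_zpow j)

lemma fourierCoefficient_mix {ι : Type*} [Fintype ι] (a : ι → ℝ≥0) (ha : ∑ i, a i = 1)
    (μ : ι → ProbabilityMeasure Circle) (j : ℤ) :
    fourierCoefficient (mix a ha μ : Measure Circle) j =
      ∑ i, (a i : ℂ) * fourierCoefficient (μ i : Measure Circle) j := by
  unfold fourierCoefficient
  rw [integral_mix a ha μ fun i => integrable_of_continuous (continuous_coe_zpow j) _]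
  simp

lemma fourierCoefficient_diracProba (z : Circle) (j : ℤ) :
    fourierCoefficient (diracProba z : Measure Circle) j = ((z ^ j : Circle) : ℂ) := by
  unfold fourierCoefficient
  exact integral_dirac _ _

/-- The distance from `1` of the `j`-th Fourier coefficient. -/
noncomputable def defect (j : ℤ) (μ : ProbabilityMeasure Circle) : ℝ :=
  ‖fourierCoefficient (μ : Measure Circle) j - 1‖

lemma continuous_defect (j : ℤ) : Continuous (defect j) :=
  ((continuous_fourierCoefficient j).sub continuous_const).norm

lemma defect_le_two (j : ℤ) (μ : ProbabilityMeasure Circle) : defect j μ ≤ 2 := by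
  have h : ‖fourierCoefficient (μ : Measure Circle) j‖ ≤ 1 := by
    refine (norm_integral_le_of_norm_le_const (μ := (μ : Measure Circle))
      (ae_of_all _ fun z : Circle => (Circle.norm_coe (z ^ j)).le)).trans ?_
    simp
  calc defect j μ ≤ ‖fourierCoefficient (μ : Measure Circle) j‖ + ‖(1 : ℂ)‖ := norm_sub_le _ _
    _ ≤ 2 := by rw [norm_one]; linarith

/-- The weights sum to `1`, so `μ̂(j) - 1` is affine in `μ` and its norm is convex. -/
lemma defect_mix_le {ι : Type*} [Fintype ι] (a : ι → ℝ≥0) (ha : ∑ i, a i = 1)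
    (μ : ι → ProbabilityMeasure Circle) (j : ℤ) :
    defect j (mix a ha μ) ≤ ∑ i, (a i : ℝ) * defect j (μ i) := by
  have h : fourierCoefficient (mix a ha μ : Measure Circle) j - 1 =
      ∑ i, (a i : ℂ) * (fourierCoefficient (μ i : Measure Circle) j - 1) := by
    have h1 : ∑ i, (a i : ℂ) = 1 := by exact_mod_cast congrArg (fun x : ℝ≥0 => (x : ℂ)) ha
    simp_rw [mul_sub, Finset.sum_sub_distrib, mul_one, h1, fourierCoefficient_mix]
  unfold defect
  rw [h]
  refine (norm_sum_le _ _).trans (Finset.sum_le_sum fun i _ => ?_)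
  rw [norm_mul]
  simp

/-- The bounds `0` and `2` keep the real `limsup` away from its default value. The gap between `b`
and `ε` is what survives finite averaging. -/
lemma limsup_lt_iff_exists_eventually_le {u : ℕ → ℝ} (h0 : ∀ k, 0 ≤ u k) (h2 : ∀ k, u k ≤ 2)
    {ε : ℝ} : limsup u atTop < ε ↔ ∃ b < ε, ∀ᶠ k in atTop, u k ≤ b := by
  have hb : IsBoundedUnder (· ≤ ·) atTop u := isBoundedUnder_of ⟨2, h2⟩
  have hc : IsCoboundedUnder (· ≤ ·) atTop u :=
    (isBoundedUnder_of ⟨0, h0⟩ : IsBoundedUnder (· ≥ ·) atTop u).isCoboundedUnder_le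
  constructor
  · intro h
    obtain ⟨b, hb1, hb2⟩ := exists_between h
    exact ⟨b, hb2, (eventually_lt_of_limsup_lt hb1 hb).mono fun _ => le_of_lt⟩
  · rintro ⟨b, hbε, h⟩
    exact (limsup_le_of_le hc h).trans_lt hbε

lemma mem_almostRigidMeasures_iff {n : ℕ → ℤ} {ε : ℝ} {μ : ProbabilityMeasure Circle} :
    μ ∈ almostRigidMeasures n ε ↔ ∃ b < ε, ∀ᶠ k in atTop, defect (n k) μ ≤ b :=
  limsup_lt_iff_exists_eventually_le (fun _ => norm_nonneg _) fun k => defect_le_two (n k) μ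

lemma mix_mem_almostRigidMeasures {n : ℕ → ℤ} {ε : ℝ} {ι : Type*} [Fintype ι] (a : ι → ℝ≥0)
    (ha : ∑ i, a i = 1) (μ : ι → ProbabilityMeasure Circle)
    (hμ : ∀ i, μ i ∈ almostRigidMeasures n ε) : mix a ha μ ∈ almostRigidMeasures n ε := by
  simp only [mem_almostRigidMeasures_iff] at hμ ⊢
  choose b hb hμ using hμ
  have ha' : ∑ i, (a i : ℝ) = 1 := by exact_mod_cast ha
  refine ⟨∑ i, (a i : ℝ) * b i, ?_, ?_⟩
  · calc ∑ i, (a i : ℝ) * b i < ∑ i, (a i : ℝ) * ε := by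
          -- Strictness needs one weight that is nonzero, which exists because the weights sum to
          -- `1`.
          obtain ⟨i, hi⟩ : ∃ i, a i ≠ 0 := by
            by_contra! h
            simp [h] at ha
          refine Finset.sum_lt_sum (fun i _ => mul_le_mul_of_nonneg_left (hb i).le (a i).2)
            ⟨i, Finset.mem_univ i, mul_lt_mul_of_pos_left (hb i) ?_⟩
          exact_mod_cast pos_iff_ne_zero.2 hi
      _ = ε := by rw [← Finset.sum_mul, ha', one_mul]
  · filter_upwards [eventually_all.2 hμ] with k hk
    exact (defect_mix_le a ha μ _).trans
      (Finset.sum_le_sum fun i _ => mul_le_mul_of_nonneg_left (hk i) (a i).2)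

/-- The coefficients of a Dirac mass at `z` are the powers of `z`, so almost rigid points give
almost rigid Dirac masses, and convexity does the rest. -/
lemma dense_almostRigidMeasures_of_dense_points {n : ℕ → ℤ} {ε : ℝ}
    (h : Dense (almostRigidPoints n ε)) : Dense (almostRigidMeasures n ε) := by
  refine dense_of_mix_mem (fun F a ha μ hμ => mix_mem_almostRigidMeasures a ha μ hμ) (h.mono ?_)
  intro z hz
  simpa only [Set.mem_ofPred_eq, almostRigidMeasures, almostRigidPoints,
    fourierCoefficient_diracProba] using hz

/-- The measures whose Fourier coefficients tend to `1` along `n`. -/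
def rigidMeasures (n : ℕ → ℤ) : Set (ProbabilityMeasure Circle) :=
  {μ | Tendsto (fun k => fourierCoefficient (μ : Measure Circle) (n k)) atTop (𝓝 1)}

lemma mix_mem_rigidMeasures {n : ℕ → ℤ} {ι : Type*} [Fintype ι] (a : ι → ℝ≥0)
    (ha : ∑ i, a i = 1) (μ : ι → ProbabilityMeasure Circle) (hμ : ∀ i, μ i ∈ rigidMeasures n) :
    mix a ha μ ∈ rigidMeasures n := by
  have h1 : ∑ i, (a i : ℂ) * 1 = 1 := by
    simpa using congrArg (fun x : ℝ≥0 => (x : ℂ)) ha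
  change Tendsto (fun k => fourierCoefficient (mix a ha μ : Measure Circle) (n k)) atTop (𝓝 1)
  simp_rw [fourierCoefficient_mix]
  rw [← h1]
  exact tendsto_finsetSum _ fun i _ => tendsto_const_nhds.mul (hμ i)

lemma rigidMeasures_subset_almostRigidMeasures {n : ℕ → ℤ} {ε : ℝ} (hε : 0 < ε) :
    rigidMeasures n ⊆ almostRigidMeasures n ε := by
  intro μ hμ
  refine mem_almostRigidMeasures_iff.2 ⟨ε / 2, half_lt_self hε, ?_⟩
  filter_upwards [Metric.tendsto_nhds.1 hμ (ε / 2) (half_pos hε)] with k hk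
  rw [dist_eq_norm] at hk
  exact hk.le

/-! ### The subgroup of rigid points; density from one atomless rigid measure -/

/-- Convolution of probability measures on the circle. -/
noncomputable def conv (μ ν : ProbabilityMeasure Circle) : ProbabilityMeasure Circle :=
  (μ.prod ν).map (f := fun p : Circle × Circle => p.1 * p.2) continuous_mul.aemeasurable

lemma continuous_conv :
    Continuous fun p : ProbabilityMeasure Circle × ProbabilityMeasure Circle => conv p.1 p.2 :=
  (ProbabilityMeasure.continuous_map continuous_mul).comp ProbabilityMeasure.continuous_prod

lemma fourierCoefficient_conv (μ ν : ProbabilityMeasure Circle) (j : ℤ) :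
    fourierCoefficient (conv μ ν : Measure Circle) j =
      fourierCoefficient (μ : Measure Circle) j * fourierCoefficient (ν : Measure Circle) j := by
  unfold fourierCoefficient conv
  rw [ProbabilityMeasure.toMeasure_map, integral_map continuous_mul.aemeasurable
    (continuous_coe_zpow j).aestronglyMeasurable, ProbabilityMeasure.toMeasure_prod,
    ← integral_prod_mul]
  simp [mul_zpow]

lemma conv_diracProba (z w : Circle) : conv (diracProba z) (diracProba w) = diracProba (z * w) := by
  apply Subtype.ext
  change ((Measure.dirac z).prod (Measure.dirac w)).map (fun p : Circle × Circle => p.1 * p.2) =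
    Measure.dirac (z * w)
  rw [Measure.dirac_prod_dirac, Measure.map_dirac' continuous_mul.measurable]

/-- The image of a probability measure on the circle under inversion. -/
noncomputable def reflect (μ : ProbabilityMeasure Circle) : ProbabilityMeasure Circle :=
  μ.map (f := fun z : Circle => z⁻¹) continuous_inv.aemeasurable

lemma fourierCoefficient_reflect (μ : ProbabilityMeasure Circle) (j : ℤ) :
    fourierCoefficient (reflect μ : Measure Circle) j =
      (starRingEnd ℂ) (fourierCoefficient (μ : Measure Circle) j) := by
  unfold fourierCoefficient reflect
  rw [ProbabilityMeasure.toMeasure_map, integral_map continuous_inv.aemeasurable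
    (continuous_coe_zpow j).aestronglyMeasurable, ← integral_conj]
  refine integral_congr_ae (ae_of_all _ fun z => ?_)
  simp only [inv_zpow, Circle.coe_inv_eq_conj]

lemma reflect_diracProba (z : Circle) : reflect (diracProba z) = diracProba z⁻¹ := by
  apply Subtype.ext
  change (Measure.dirac z).map (fun z : Circle => z⁻¹) = Measure.dirac z⁻¹
  rw [Measure.map_dirac' continuous_inv.measurable]

/-- The points whose Dirac masses are limits of measures rigid along `n`. -/
noncomputable def rigidPoints (n : ℕ → ℤ) : Subgroup Circle where
  carrier := {z | diracProba z ∈ closure (rigidMeasures n)}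
  one_mem' := by
    refine subset_closure ?_
    simp [rigidMeasures, fourierCoefficient_diracProba]
  -- Convolution multiplies Fourier coefficients and reflection conjugates them, so both preserve
  -- the limit `1`; on Dirac masses they are multiplication and inversion of points.
  mul_mem' {z w} hz hw := by
    rw [Set.mem_ofPred_eq, ← conv_diracProba]
    refine map_mem_closure₂ continuous_conv hz hw fun μ hμ ν hν => ?_
    simpa only [rigidMeasures, Set.mem_ofPred_eq, fourierCoefficient_conv, mul_one] using hμ.mul hν
  inv_mem' {z} hz := by
    rw [Set.mem_ofPred_eq, ← reflect_diracProba]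
    refine map_mem_closure (ProbabilityMeasure.continuous_map continuous_inv) hz fun μ hμ => ?_
    change Tendsto (fun k => fourierCoefficient (reflect μ : Measure Circle) (n k)) atTop (𝓝 1)
    simp_rw [fourierCoefficient_reflect]
    have := (Complex.continuous_conj.tendsto 1).comp hμ
    rwa [map_one] at this

/-- The preimage in `ℝ` under `exp` is dense or cyclic. A cyclic one contains `2π`, so the
exponential of its generator has finite order and `H` is finite. -/
lemma dense_subgroup_circle_of_infinite (H : Subgroup Circle) (hH : (H : Set Circle).Infinite) :
    Dense (H : Set Circle) := by
  let K : AddSubgroup ℝ := (Subgroup.toAddSubgroup H).comap Circle.expHom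
  have hK : ∀ t : ℝ, t ∈ K ↔ Circle.exp t ∈ H := fun t => Iff.rfl
  rcases AddSubgroup.dense_or_cyclic K with h | ⟨a, ha⟩
  · refine (Circle.exp_surjective.denseRange.dense_image Circle.exp.continuous h).mono ?_
    rintro _ ⟨t, ht, rfl⟩
    exact (hK t).1 ht
  · exfalso
    have h2 : 2 * Real.pi ∈ K := by rw [hK, Circle.exp_two_pi]; exact H.one_mem
    rw [ha, AddSubgroup.mem_closure_singleton] at h2
    obtain ⟨m, hm⟩ := h2
    have hfin : IsOfFinOrder (Circle.exp a) := by
      rw [isOfFinOrder_iff_zpow_eq_one]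
      refine ⟨m, ?_, ?_⟩
      · rintro rfl
        rw [zero_smul] at hm
        exact Real.two_pi_pos.ne hm
      · rw [← Circle.exp_zsmul, hm, Circle.exp_two_pi]
    refine hH (Set.Finite.subset hfin.finite_zpowers ?_)
    intro z hz
    obtain ⟨t, rfl⟩ := Circle.exp_surjective z
    have : t ∈ K := (hK t).2 hz
    rw [ha, AddSubgroup.mem_closure_singleton] at this
    obtain ⟨l, rfl⟩ := this
    exact ⟨l, (Circle.exp_zsmul a l).symm⟩

/-- On the circle `|w - 1|² = 2 - 2 Re w`, so convergence of the coefficients upgrades to `z ^ n_k →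
1` in `L²(σ)`. Unlike the coefficients, this form passes to dominated measures. -/
lemma tendsto_integral_normSq_sub_one {n : ℕ → ℤ} {σ : ProbabilityMeasure Circle}
    (hσ : σ ∈ rigidMeasures n) :
    Tendsto (fun k => ∫ z : Circle, ‖((z ^ n k : Circle) : ℂ) - 1‖ ^ 2 ∂(σ : Measure Circle))
      atTop (𝓝 0) := by
  have h : ∀ k, ∫ z : Circle, ‖((z ^ n k : Circle) : ℂ) - 1‖ ^ 2 ∂(σ : Measure Circle) =
      2 - 2 * (fourierCoefficient (σ : Measure Circle) (n k)).re := by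
    intro k
    have hint : Integrable (fun z : Circle => ((z ^ n k : Circle) : ℂ)) (σ : Measure Circle) :=
      integrable_of_continuous (continuous_coe_zpow _) _
    have hre : ∫ z : Circle, ((z ^ n k : Circle) : ℂ).re ∂(σ : Measure Circle) =
        (fourierCoefficient (σ : Measure Circle) (n k)).re := integral_re hint
    rw [← hre, ← integral_const_mul]
    have h2 : ∫ z : Circle, (2 : ℝ) ∂(σ : Measure Circle) = 2 := by simp
    have hsub := integral_sub (integrable_const (2 : ℝ)) (hint.re.const_mul 2)
    rw [h2] at hsub
    refine Eq.trans ?_ hsub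
    refine integral_congr_ae (ae_of_all _ fun z => ?_)
    have h1 : Complex.normSq ((z ^ n k : Circle) : ℂ) = 1 := Circle.normSq_coe _
    simp only [← Complex.normSq_eq_norm_sq, Complex.normSq_sub, h1]
    simp
    ring
  simp_rw [h]
  have := ((Complex.continuous_re.tendsto 1).comp hσ).const_mul (2 : ℝ) |>.const_sub 2
  simpa using this

/-- A rigid measure conditioned to a set of positive measure is rigid. -/
lemma cond_mem_rigidMeasures {n : ℕ → ℤ} {σ : ProbabilityMeasure Circle}
    (hσ : σ ∈ rigidMeasures n) {A : Set Circle} (hA : (σ : Measure Circle) A ≠ 0) :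
    (⟨ProbabilityTheory.cond σ A, ProbabilityTheory.cond_isProbabilityMeasure hA⟩ :
      ProbabilityMeasure Circle) ∈ rigidMeasures n := by
  have : IsProbabilityMeasure (ProbabilityTheory.cond (σ : Measure Circle) A) :=
    ProbabilityTheory.cond_isProbabilityMeasure hA
  set c : ℝ := ((σ : Measure Circle) A)⁻¹.toReal with hc
  -- The conditioned measure is dominated by `c • σ`, so convergence in `L²(σ)` carries over;
  -- Jensen's inequality then returns to the Fourier coefficient.
  have hle : ∀ f : Circle → ℝ, Continuous f → (∀ z, 0 ≤ f z) →
      ∫ z, f z ∂(ProbabilityTheory.cond (σ : Measure Circle) A) ≤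
        c * ∫ z, f z ∂(σ : Measure Circle) := by
    intro f hf h0
    rw [ProbabilityTheory.cond, integral_smul_measure, smul_eq_mul]
    exact mul_le_mul_of_nonneg_left (integral_mono_measure Measure.restrict_le_self
      (ae_of_all _ h0) (integrable_of_continuous hf _)) ENNReal.toReal_nonneg
  change Tendsto (fun k => fourierCoefficient (ProbabilityTheory.cond (σ : Measure Circle) A) (n k))
    atTop (𝓝 1)
  rw [tendsto_iff_norm_sub_tendsto_zero]
  have hbound : ∀ k, ‖fourierCoefficient (ProbabilityTheory.cond (σ : Measure Circle) A) (n k) - 1‖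
      ≤ √(c * ∫ z : Circle, ‖((z ^ n k : Circle) : ℂ) - 1‖ ^ 2 ∂(σ : Measure Circle)) := by
    intro k
    have hcont : Continuous fun z : Circle => ‖((z ^ n k : Circle) : ℂ) - 1‖ :=
      ((continuous_coe_zpow _).sub continuous_const).norm
    refine Real.le_sqrt_of_sq_le ?_
    have h1 : fourierCoefficient (ProbabilityTheory.cond (σ : Measure Circle) A) (n k) - 1 =
        ∫ z : Circle, (((z ^ n k : Circle) : ℂ) - 1)
          ∂(ProbabilityTheory.cond (σ : Measure Circle) A) := by
      rw [integral_sub (integrable_of_continuous (continuous_coe_zpow _) _) (integrable_const _)]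
      simp [fourierCoefficient]
    rw [h1]
    calc _ ≤ (∫ z : Circle, ‖((z ^ n k : Circle) : ℂ) - 1‖
            ∂(ProbabilityTheory.cond (σ : Measure Circle) A)) ^ 2 := by
          gcongr
          exact norm_integral_le_integral_norm _
      _ ≤ ∫ z : Circle, ‖((z ^ n k : Circle) : ℂ) - 1‖ ^ 2
            ∂(ProbabilityTheory.cond (σ : Measure Circle) A) :=
          (convexOn_pow 2).map_integral_le (continuous_pow 2).continuousOn isClosed_Ici
            (ae_of_all _ fun z => norm_nonneg _) (integrable_of_continuous hcont _)
            (integrable_of_continuous (hcont.pow 2) _)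
      _ ≤ _ := hle _ (hcont.pow 2) fun z => by positivity
  refine squeeze_zero (fun _ => norm_nonneg _) hbound ?_
  have := ((tendsto_integral_normSq_sub_one hσ).const_mul c).sqrt
  simpa using this

/-- Conditioning to shrinking balls around a point of the support gives the Dirac mass. -/
lemma mem_rigidPoints_of_mem_support {n : ℕ → ℤ} {σ : ProbabilityMeasure Circle}
    (hσ : σ ∈ rigidMeasures n) {z : Circle} (hz : ∀ r > 0, (σ : Measure Circle) (Metric.ball z r) ≠ 0) :
    z ∈ rigidPoints n := by
  have hr : ∀ i : ℕ, (0 : ℝ) < 1 / (i + 1) := fun i => by positivity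
  refine mem_closure_of_tendsto (b := atTop) (f := fun i : ℕ =>
    (⟨ProbabilityTheory.cond σ (Metric.ball z (1 / ((i : ℝ) + 1))),
      ProbabilityTheory.cond_isProbabilityMeasure (hz _ (hr i))⟩ : ProbabilityMeasure Circle)) ?_
    (Eventually.of_forall fun i => cond_mem_rigidMeasures hσ (hz _ (hr i)))
  refine tendsto_probabilityMeasure_iff.2 fun f hf => ?_
  have hd : ∫ x, f x ∂(diracProba z : Measure Circle) = f z := integral_dirac _ _
  rw [hd, Metric.tendsto_atTop]
  intro ε hε
  obtain ⟨δ, hδ, hfδ⟩ := Metric.continuous_iff.1 hf z (ε / 2) (half_pos hε)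
  obtain ⟨N, hN⟩ := exists_nat_one_div_lt hδ
  refine ⟨N, fun i hi => ?_⟩
  set ν := ProbabilityTheory.cond (σ : Measure Circle) (Metric.ball z (1 / ((i : ℝ) + 1)))
  have : IsProbabilityMeasure ν := ProbabilityTheory.cond_isProbabilityMeasure (hz _ (hr i))
  have hsub : ∫ x, f x ∂ν - f z = ∫ x, (f x - f z) ∂ν := by
    rw [integral_sub (integrable_of_continuous hf _) (integrable_const _)]
    simp
  change dist (∫ x, f x ∂ν) (f z) < ε
  rw [dist_eq_norm, hsub]
  have hae : ∀ᵐ x ∂ν, ‖f x - f z‖ ≤ ε / 2 := by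
    have : ∀ᵐ x ∂ν, x ∈ Metric.ball z (1 / ((i : ℝ) + 1)) :=
      ProbabilityTheory.ae_cond_mem Metric.isOpen_ball.measurableSet
    filter_upwards [this] with x hx
    rw [← dist_eq_norm]
    refine (hfδ x ?_).le
    refine (Metric.mem_ball.1 hx).trans (lt_of_le_of_lt ?_ hN)
    exact one_div_le_one_div_of_le (by positivity) (by exact_mod_cast Nat.succ_le_succ hi)
  have := norm_integral_le_of_norm_le_const hae
  simp only [probReal_univ, mul_one] at this
  linarith

/-- The support of `σ` has full measure and lies in `rigidPoints n`. A finite set is null for an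
atomless measure, so that subgroup is infinite, hence dense. -/
lemma dense_almostRigidMeasures_of_atomless {n : ℕ → ℤ} {σ : ProbabilityMeasure Circle}
    (hσ : σ ∈ rigidMeasures n) (hc : ∀ z : Circle, (σ : Measure Circle) {z} = 0)
    {ε : ℝ} (hε : 0 < ε) : Dense (almostRigidMeasures n ε) := by
  suffices h : Dense (rigidMeasures n) from h.mono (rigidMeasures_subset_almostRigidMeasures hε)
  -- The Dirac masses are only known to lie in the closure, so the convexity argument is run for the
  -- closure.
  rw [← dense_closure]
  refine dense_of_mix_mem (fun F a ha μ hμ => mix_mem_closure a ha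
    (fun ν hν => mix_mem_rigidMeasures a ha ν hν) μ hμ) ?_
  refine dense_subgroup_circle_of_infinite (rigidPoints n) fun hfin => ?_
  have hsupp : (σ : Measure Circle).support ⊆ rigidPoints n := by
    intro z hz
    refine mem_rigidPoints_of_mem_support hσ fun r hr => ?_
    exact ((Measure.mem_support_iff_forall z).1 hz _ (Metric.ball_mem_nhds z hr)).ne'
  have : NullSingletonClass (σ : Measure Circle) := ⟨hc⟩
  have h0 : (σ : Measure Circle) (σ : Measure Circle).support = 0 :=
    (hfin.subset hsupp).measure_zero _
  have h1 : (σ : Measure Circle) (σ : Measure Circle).supportᶜ = 0 :=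
    Measure.measure_compl_support
  have : (σ : Measure Circle) Set.univ ≤ 0 := by
    rw [← Set.union_compl_self (σ : Measure Circle).support]
    exact (measure_union_le _ _).trans (by simp [h0, h1])
  simp at this

/-! ### Measures with small atoms form an open dense set -/

/-- The probability measures on the circle all of whose atoms have mass less than `δ`. -/
def smallAtoms (δ : ℝ≥0∞) : Set (ProbabilityMeasure Circle) :=
  {μ | ∀ z : Circle, (μ : Measure Circle) {z} < δ}

/-- Finitely many closed balls of `μ`-mass less than `δ` cover the circle. The mass of a closed set
is upper semicontinuous, and every atom is bounded by the mass of a ball containing it. -/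
lemma isOpen_smallAtoms (δ : ℝ≥0∞) : IsOpen (smallAtoms δ) := by
  rw [isOpen_iff_mem_nhds]
  intro μ hμ
  have hball : ∀ z : Circle, ∃ r > 0, (μ : Measure Circle) (Metric.closedBall z r) < δ := by
    intro z
    have ht : Tendsto (fun r => (μ : Measure Circle) (Metric.cthickening r {z})) (𝓝 0)
        (𝓝 ((μ : Measure Circle) {z})) :=
      tendsto_measure_cthickening_of_isClosed ⟨1, one_pos, measure_ne_top _ _⟩ isClosed_singleton
    have hev := (ht.eventually_lt_const (hμ z))
    obtain ⟨r, hr, h⟩ := ((hev.filter_mono nhdsWithin_le_nhds).and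
      (self_mem_nhdsWithin (s := Set.Ioi (0 : ℝ)))).exists
    refine ⟨r, h, ?_⟩
    rw [← Metric.cthickening_singleton z (le_of_lt h)]
    exact hr
  choose r hr0 hr using hball
  obtain ⟨t, ht⟩ := isCompact_univ.elim_nhds_subcover (fun z => Metric.closedBall z (r z))
    fun z _ => Metric.closedBall_mem_nhds z (hr0 z)
  have hev : ∀ z, ∀ᶠ ν : ProbabilityMeasure Circle in 𝓝 μ,
      (ν : Measure Circle) (Metric.closedBall z (r z)) < δ := fun z =>
    eventually_lt_of_limsup_lt ((ProbabilityMeasure.limsup_measure_closed_le_of_tendsto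
      (tendsto_id (α := ProbabilityMeasure Circle)) Metric.isClosed_closedBall).trans_lt (hr z))
  filter_upwards [(Filter.eventually_all_finset t).2 fun z _ => hev z] with ν hν w
  obtain ⟨z, hz, hw⟩ := Set.mem_iUnion₂.1 (ht.2 (Set.mem_univ w))
  exact (measure_mono (Set.singleton_subset_iff.2 hw)).trans_lt (hν z hz)

lemma mix_mem_smallAtoms {ι : Type*} [Fintype ι] (a : ι → ℝ≥0) (ha : ∑ i, a i = 1)
    {δ : ℝ≥0∞} (μ : ι → ProbabilityMeasure Circle) (hμ : ∀ i, μ i ∈ smallAtoms δ) :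
    mix a ha μ ∈ smallAtoms δ := by
  intro z
  rw [toMeasure_mix, Measure.coe_finsetSum, Finset.sum_apply]
  simp only [Measure.smul_apply, ENNReal.smul_def, smul_eq_mul]
  obtain ⟨i, hi⟩ : ∃ i, a i ≠ 0 := by
    by_contra! h
    simp [h] at ha
  have : Nonempty ι := ⟨i⟩
  obtain ⟨j, -, hj⟩ := Finset.exists_max_image Finset.univ
    (fun i => (μ i : Measure Circle) {z}) ⟨i, Finset.mem_univ i⟩
  calc ∑ i, (a i : ℝ≥0∞) * (μ i : Measure Circle) {z}
      ≤ ∑ i, (a i : ℝ≥0∞) * (μ j : Measure Circle) {z} :=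
        Finset.sum_le_sum fun i _ => mul_le_mul_right (hj i (Finset.mem_univ i)) _
    _ = (μ j : Measure Circle) {z} := by
        rw [← Finset.sum_mul, ← ENNReal.ofNNReal_finsetSum, ha, ENNReal.coe_one, one_mul]
    _ < δ := hμ j z

lemma countable_exp_preimage (w : Circle) {c : ℝ} (hc : c ≠ 0) :
    {t : ℝ | Circle.exp (t * c) = w}.Countable := by
  rcases Set.eq_empty_or_nonempty {t : ℝ | Circle.exp (t * c) = w} with h | ⟨s, hs⟩
  · rw [h]; exact Set.countable_empty
  · refine (Set.countable_range fun m : ℤ => s + m * (2 * Real.pi) / c).mono fun t ht => ?_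
    obtain ⟨m, hm⟩ := Circle.exp_eq_exp.1 ((show Circle.exp (t * c) = w from ht).trans
      (show Circle.exp (s * c) = w from hs).symm)
    exact ⟨m, by field_simp; linarith⟩

/-- A Gaussian wrapped around the circle at `z` with scale tending to `0` converges to the Dirac
mass. It has no atoms because the wrapping map has countable fibres. -/
lemma diracProba_mem_closure_atomless (z : Circle) :
    diracProba z ∈ closure {μ : ProbabilityMeasure Circle | ∀ w, (μ : Measure Circle) {w} = 0} := by
  let ν : ProbabilityMeasure ℝ := ⟨ProbabilityTheory.gaussianReal 0 1, inferInstance⟩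
  have hs : ∀ i : ℕ, Measurable fun t : ℝ => z * Circle.exp (t * (1 / ((i : ℝ) + 1))) := fun i =>
    (continuous_const.mul (Circle.exp.continuous.comp (continuous_mul_const _))).measurable
  have h := tendsto_map_of_pointwise ν hs (t := fun _ => z) measurable_const fun t => by
    have h1 : Tendsto (fun i : ℕ => t * (1 / ((i : ℝ) + 1))) atTop (𝓝 0) := by
      simpa using tendsto_one_div_add_atTop_nhds_zero_nat.const_mul t
    have := ((Circle.exp.continuous.tendsto 0).comp h1).const_mul z
    rwa [Circle.exp_zero, mul_one] at this
  have hz : ν.map (measurable_const (a := z)).aemeasurable = diracProba z := by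
    apply Subtype.ext
    change (ν : Measure ℝ).map (fun _ => z) = Measure.dirac z
    rw [Measure.map_const, measure_univ, one_smul]
  rw [hz] at h
  refine mem_closure_of_tendsto h (Eventually.of_forall fun i w => ?_)
  rw [ProbabilityMeasure.toMeasure_map, Measure.map_apply (hs i) (measurableSet_singleton w)]
  have : NullSingletonClass (ν : Measure ℝ) :=
    ProbabilityTheory.nullSingletonClass_gaussianReal one_ne_zero
  refine Set.Countable.measure_zero ?_ _
  refine (countable_exp_preimage (z⁻¹ * w) (c := 1 / ((i : ℝ) + 1)) (by positivity)).mono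
    fun t ht => ?_
  have ht : z * Circle.exp (t * (1 / ((i : ℝ) + 1))) = w := ht
  exact eq_inv_mul_of_mul_eq ht

lemma dense_smallAtoms {δ : ℝ≥0∞} (hδ : 0 < δ) : Dense (smallAtoms δ) := by
  have hd : Dense {μ : ProbabilityMeasure Circle | ∀ w, (μ : Measure Circle) {w} = 0} := by
    rw [← dense_closure]
    refine dense_of_mix_mem (fun F a ha μ hμ => mix_mem_closure a ha ?_ μ hμ) ?_
    · intro ν hν w
      rw [toMeasure_mix, Measure.coe_finsetSum, Finset.sum_apply]
      exact Finset.sum_eq_zero fun i _ => by simp [hν i w]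
    · exact dense_univ.mono fun z _ => diracProba_mem_closure_atomless z
  exact hd.mono fun μ hμ z => (hμ z).trans_lt hδ

/-! ### Construction of an atomless rigid measure from density -/

/-- Averaging many measures with disjoint windows of uncontrolled Fourier coefficients. -/
lemma exists_average {n : ℕ → ℤ} (hd : ∀ ε : ℝ, 0 < ε → Dense (almostRigidMeasures n ε))
    {μ₀ : ProbabilityMeasure Circle} {K : ℕ} {ε ε' : ℝ} (hε' : 0 < ε') (hle : ε' ≤ ε)
    (hμ₀ : ∀ k ≥ K, defect (n k) μ₀ ≤ ε) {U : Set (ProbabilityMeasure Circle)} (hU : U ∈ 𝓝 μ₀)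
    {δ : ℝ≥0∞} (hδ : 0 < δ) :
    ∃ μ ∈ U ∩ smallAtoms δ, ∃ K' > K, (∀ k ≥ K, defect (n k) μ ≤ 2 * ε) ∧
      ∀ k ≥ K', defect (n k) μ ≤ ε' := by
  have hε : 0 < ε := hε'.trans_le hle
  -- With `N ε > 4`, a single term of size `2` is absorbed: `N · (3/2) ε + 2 ≤ N · 2ε`.
  obtain ⟨N, hN⟩ := exists_nat_gt (4 / ε)
  have hN0 : (0 : ℝ) < N := (by positivity : 0 < 4 / ε).trans hN
  have hN1 : N ≠ 0 := by rintro rfl; simp at hN0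
  let a : Fin N → ℝ≥0 := fun _ => (N : ℝ≥0)⁻¹
  have ha : ∑ i, a i = 1 := by
    simp only [a, Finset.sum_const, Finset.card_univ, Fintype.card_fin, nsmul_eq_mul]
    exact mul_inv_cancel₀ (by exact_mod_cast hN1)
  obtain ⟨V, hV, hVU⟩ : ∃ V ∈ 𝓝 μ₀, ∀ μ : Fin N → ProbabilityMeasure Circle,
      (∀ i, μ i ∈ V) → mix a ha μ ∈ U := by
    have h1 : (fun μ : Fin N → ProbabilityMeasure Circle => mix a ha μ) ⁻¹' U ∈
        𝓝 (fun _ => μ₀) := by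
      refine (continuous_mix a ha).continuousAt.preimage_mem_nhds ?_
      rwa [mix_const]
    rw [nhds_pi, Filter.mem_pi'] at h1
    obtain ⟨I, t, ht, hsub⟩ := h1
    exact ⟨⋂ i, t i, (Filter.iInter_mem).2 ht,
      fun μ hμ => hsub fun i _ => Set.mem_iInter.1 (hμ i) i⟩
  -- Closeness to `μ₀` controls the finitely many indices up to `M`, and almost rigidity controls
  -- those from some `M'` on. Only the window strictly between `M` and `M'` is uncontrolled.
  have hstep : ∀ M : ℕ, ∃ ν : ProbabilityMeasure Circle, ∃ M' > M, ν ∈ V ∧ ν ∈ smallAtoms δ ∧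
      (∀ k ≥ K, k ≤ M → defect (n k) ν ≤ 3 / 2 * ε) ∧ ∀ k ≥ M', defect (n k) ν ≤ ε' := by
    intro M
    have hW : V ∩ {ν | ∀ k ∈ Finset.Icc K M, defect (n k) ν < 3 / 2 * ε} ∈ 𝓝 μ₀ := by
      refine inter_mem hV ((Filter.eventually_all_finset _).2 fun k hk => ?_)
      refine (continuous_defect (n k)).continuousAt.eventually_lt_const ?_
      have := hμ₀ k (Finset.mem_Icc.1 hk).1
      linarith
    obtain ⟨ν, ⟨hνr, hνs⟩, hν⟩ := ((hd ε' hε').inter_of_isOpen_right (dense_smallAtoms hδ)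
      (isOpen_smallAtoms δ)).inter_nhds_nonempty hW
    obtain ⟨b, hb, hev⟩ := mem_almostRigidMeasures_iff.1 hνr
    obtain ⟨M', hM'⟩ := eventually_atTop.1 hev
    refine ⟨ν, max (M + 1) M', lt_of_lt_of_le (Nat.lt_succ_self M) (le_max_left _ _), hν.1, hνs,
      fun k h1 h2 => (hν.2 k (Finset.mem_Icc.2 ⟨h1, h2⟩)).le,
      fun k hk => (hM' k ((le_max_right _ _).trans hk)).trans hb.le⟩
  choose ν f hf hνV hνs hνK hνf using hstep
  -- Each window starts where the previous one ends, which makes the uncontrolled windows disjoint.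
  let M : ℕ → ℕ := fun i => f^[i] K
  have hM : StrictMono M := strictMono_nat_of_lt_succ fun i => by
    simp only [M, Function.iterate_succ_apply']
    exact hf _
  have hMf : ∀ i, f (M i) = M (i + 1) := fun i => (Function.iterate_succ_apply' f i K).symm
  let μ : Fin N → ProbabilityMeasure Circle := fun i => ν (M i)
  refine ⟨mix a ha μ, ⟨hVU μ fun i => hνV _, mix_mem_smallAtoms a ha μ fun i => hνs _⟩, M N, ?_,
    ?_, ?_⟩
  · exact hM (Nat.pos_of_ne_zero hN1)
  · intro k hk
    -- at most one index `i` has `M i < k < M (i + 1)`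
    have hbound : ∀ i : Fin N, defect (n k) (μ i) ≤
        3 / 2 * ε + if M i < k ∧ k < M (i + 1) then 2 else 0 := by
      intro i
      split_ifs with h
      · have := defect_le_two (n k) (μ i)
        linarith
      · rw [add_zero]
        rcases le_or_gt k (M i) with h1 | h1
        · exact hνK _ k hk h1
        · have h2 : M (i + 1) ≤ k := not_lt.1 fun h2 => h ⟨h1, h2⟩
          have := hνf (M i) k (by rw [hMf]; exact h2)
          linarith
    have hcard : ∑ i : Fin N, (if M i < k ∧ k < M (i + 1) then (2 : ℝ) else 0) ≤ 2 := by
      rw [← Finset.sum_filter, Finset.sum_const, nsmul_eq_mul]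
      have : (Finset.univ.filter fun i : Fin N => M i < k ∧ k < M (i + 1)).card ≤ 1 := by
        refine Finset.card_le_one.2 fun i hi j hj => ?_
        simp only [Finset.mem_filter, Finset.mem_univ, true_and] at hi hj
        have h1 : (i : ℕ) < j + 1 := hM.lt_iff_lt.1 (hi.1.trans hj.2)
        have h2 : (j : ℕ) < i + 1 := hM.lt_iff_lt.1 (hj.1.trans hi.2)
        ext; omega
      have : ((Finset.univ.filter fun i : Fin N => M i < k ∧ k < M (i + 1)).card : ℝ) ≤ 1 := by
        exact_mod_cast this
      linarith
    have hsum : ∑ i : Fin N, (a i : ℝ) * defect (n k) (μ i) =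
        (N : ℝ)⁻¹ * ∑ i, defect (n k) (μ i) := by
      rw [Finset.mul_sum]; simp [a]
    refine (defect_mix_le a ha μ _).trans ?_
    rw [hsum, inv_mul_le_iff₀ hN0]
    have h4 : 4 < N * ε := by rwa [div_lt_iff₀ hε] at hN
    calc ∑ i, defect (n k) (μ i)
        ≤ ∑ i : Fin N, (3 / 2 * ε + if M i < k ∧ k < M (i + 1) then 2 else 0) :=
          Finset.sum_le_sum fun i _ => hbound i
      _ ≤ N * (3 / 2 * ε) + 2 := by
          rw [Finset.sum_add_distrib]
          simp only [Finset.sum_const, Finset.card_univ, Fintype.card_fin, nsmul_eq_mul]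
          linarith
      _ ≤ N * (2 * ε) := by linarith
  · intro k hk
    refine (defect_mix_le a ha μ _).trans ?_
    have ha' : ∑ i, (a i : ℝ) = 1 := by exact_mod_cast ha
    calc ∑ i, (a i : ℝ) * defect (n k) (μ i) ≤ ∑ i, (a i : ℝ) * ε' :=
          Finset.sum_le_sum fun i _ => mul_le_mul_of_nonneg_left
            (hνf _ k (by rw [hMf]; exact (hM.monotone i.2).trans hk)) (a i).2
      _ = ε' := by rw [← Finset.sum_mul, ha', one_mul]

/-- If the almost rigid measures are dense then some atomless measure is rigid along `n`. -/
lemma exists_atomless_rigid {n : ℕ → ℤ}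
    (hd : ∀ ε : ℝ, 0 < ε → Dense (almostRigidMeasures n ε)) :
    ∃ σ ∈ rigidMeasures n, ∀ z : Circle, (σ : Measure Circle) {z} = 0 := by
  let e : ℕ → ℝ := fun j => (1 / 2) ^ j
  have he : ∀ j, 0 < e j := fun j => by positivity
  let δ : ℕ → ℝ≥0∞ := fun j => ((j : ℝ≥0∞) + 1)⁻¹
  have hδ : ∀ j, 0 < δ j := fun j => by simp [δ]
  -- A stage records a measure, the index from which its error is at most `e j`, and a closed
  -- neighbourhood in which all later stages stay.
  let Inv : ℕ → ProbabilityMeasure Circle × ℕ × Set (ProbabilityMeasure Circle) → Prop :=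
    fun j s => s.2.2 ∈ 𝓝 s.1 ∧ IsClosed s.2.2 ∧ ∀ k ≥ s.2.1, defect (n k) s.1 ≤ e j
  have hstep : ∀ j s, Inv j s → ∃ s', Inv (j + 1) s' ∧ s'.2.2 ⊆ s.2.2 ∩ smallAtoms (δ j) ∧
      s.2.1 < s'.2.1 ∧ ∀ ν ∈ s'.2.2, ∀ k ≥ s.2.1, k ≤ s'.2.1 → defect (n k) ν ≤ 3 * e j := by
    rintro j ⟨μ, K, U⟩ ⟨hU, -, hK⟩
    obtain ⟨μ', hμ', K', hKK', h2, h1⟩ := exists_average hd (he (j + 1))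
      (pow_le_pow_of_le_one (by norm_num) (by norm_num) j.le_succ : e (j + 1) ≤ e j) hK
      (interior_mem_nhds.2 hU) (hδ j)
    -- Relaxing `2 * e j` to the open condition `< 3 * e j` on a finite window makes it hold near
    -- `μ'`, hence for every measure in the next neighbourhood.
    have hW : (interior U ∩ smallAtoms (δ j)) ∩
        {ν | ∀ k ∈ Finset.Icc K K', defect (n k) ν < 3 * e j} ∈ 𝓝 μ' := by
      refine inter_mem ((isOpen_interior.inter (isOpen_smallAtoms _)).mem_nhds hμ')
        ((Filter.eventually_all_finset _).2 fun k hk => ?_)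
      refine (continuous_defect (n k)).continuousAt.eventually_lt_const ?_
      have := h2 k (Finset.mem_Icc.1 hk).1
      have := he j
      linarith
    obtain ⟨T, hT, hTc, hTW⟩ := exists_mem_nhds_isClosed_subset hW
    refine ⟨(μ', K', T), ⟨hT, hTc, h1⟩, fun ν hν => ?_, hKK', fun ν hν k hk1 hk2 => ?_⟩
    · exact ⟨interior_subset (hTW hν).1.1, (hTW hν).1.2⟩
    · exact ((hTW hν).2 k (Finset.mem_Icc.2 ⟨hk1, hk2⟩)).le
  obtain ⟨s₀, hs₀⟩ : ∃ s, Inv 0 s := by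
    have : Nonempty (ProbabilityMeasure Circle) := ⟨diracProba 1⟩
    obtain ⟨μ, hμ⟩ := (hd 1 one_pos).nonempty
    obtain ⟨b, hb, hev⟩ := mem_almostRigidMeasures_iff.1 hμ
    obtain ⟨K, hK⟩ := eventually_atTop.1 hev
    exact ⟨(μ, K, Set.univ), univ_mem, isClosed_univ,
      fun k hk => (hK k hk).trans (by simpa [e] using hb.le)⟩
  choose! g hg hgsub hgK hgd using hstep
  let s : ℕ → ProbabilityMeasure Circle × ℕ × Set (ProbabilityMeasure Circle) :=
    fun j => Nat.rec s₀ (fun j s => g j s) j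
  have hs : ∀ j, Inv j (s j) := fun j => by
    induction j with
    | zero => exact hs₀
    | succ j ih => exact hg j (s j) ih
  have hsub : ∀ j, (s (j + 1)).2.2 ⊆ (s j).2.2 ∩ smallAtoms (δ j) := fun j => hgsub j _ (hs j)
  have hK : StrictMono fun j => (s j).2.1 := strictMono_nat_of_lt_succ fun j => hgK j _ (hs j)
  -- Any common point of the nested closed sets will do, since all required estimates hold
  -- throughout these neighbourhoods.
  obtain ⟨σ, hσ⟩ := IsCompact.nonempty_iInter_of_sequence_nonempty_isCompact_isClosed
    (fun j => (s j).2.2) (fun j => (hsub j).trans Set.inter_subset_left)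
    (fun j => ⟨_, mem_of_mem_nhds (hs j).1⟩) (hs 0).2.1.isCompact fun j => (hs j).2.1
  rw [Set.mem_iInter] at hσ
  refine ⟨σ, ?_, fun z => ?_⟩
  · change Tendsto (fun k => fourierCoefficient (σ : Measure Circle) (n k)) atTop (𝓝 1)
    rw [tendsto_iff_norm_sub_tendsto_zero, Metric.tendsto_atTop]
    intro ε hε
    obtain ⟨j₀, hj₀⟩ := exists_pow_lt_of_lt_one (by positivity : 0 < ε / 3)
      (by norm_num : (1 / 2 : ℝ) < 1)
    refine ⟨(s j₀).2.1, fun k hk => ?_⟩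
    obtain ⟨j, hj, hkj⟩ : ∃ j ≥ j₀, (s j).2.1 ≤ k ∧ k ≤ (s (j + 1)).2.1 := by
      have hex : ∃ i, k < (s i).2.1 := ⟨k + 1, lt_of_lt_of_le (Nat.lt_succ_self k) (hK.id_le _)⟩
      have h1 := Nat.find_spec hex
      have h2 : j₀ < Nat.find hex := hK.lt_iff_lt.1 (lt_of_le_of_lt hk h1)
      refine ⟨Nat.find hex - 1, by omega, not_lt.1 (Nat.find_min hex (by omega)), ?_⟩
      rw [Nat.sub_add_cancel (by omega)]
      exact h1.le
    have h3 : defect (n k) σ ≤ 3 * e j := hgd j _ (hs j) σ (hσ (j + 1)) k hkj.1 hkj.2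
    have h4 : e j ≤ e j₀ := pow_le_pow_of_le_one (by norm_num) (by norm_num) hj
    rw [Real.dist_eq, sub_zero, abs_norm]
    change defect (n k) σ < ε
    have h5 : e j₀ < ε / 3 := hj₀
    linarith
  · by_contra hne
    obtain ⟨j, hj⟩ := ENNReal.exists_inv_nat_lt hne
    have h1 := (hsub j (hσ (j + 1))).2 z
    refine lt_asymm h1 (lt_of_le_of_lt ?_ hj)
    exact ENNReal.inv_le_inv.2 (by simp)

/-! ### Haar measure, Fejér weights and Herglotz' theorem -/

/-- In a compact space every sequence of probability measures converges along the
hyperfilter. -/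
lemma exists_tendsto_hyperfilter {Ω : Type*} [MeasurableSpace Ω] [TopologicalSpace Ω]
    [OpensMeasurableSpace Ω] [CompactSpace (ProbabilityMeasure Ω)]
    (μ : ℕ → ProbabilityMeasure Ω) :
    ∃ ν, Tendsto μ (hyperfilter ℕ : Filter ℕ) (𝓝 ν) := by
  obtain ⟨ν, -, hν⟩ := isCompact_univ.ultrafilter_le_nhds ((hyperfilter ℕ).map μ) (by simp)
  exact ⟨ν, hν⟩

/-- The normalised Haar measure of the circle. -/
noncomputable def haarCircle : Measure Circle := Measure.haarMeasure ⊤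

instance : IsProbabilityMeasure haarCircle :=
  ⟨by simpa [haarCircle] using Measure.haarMeasure_self (K₀ := (⊤ : TopologicalSpace.PositiveCompacts Circle))⟩

instance : haarCircle.IsMulLeftInvariant :=
  inferInstanceAs (Measure.haarMeasure ⊤).IsMulLeftInvariant

lemma exists_zpow_ne_one {j : ℤ} (hj : j ≠ 0) : ∃ w : Circle, w ^ j ≠ 1 := by
  have hj' : (j : ℝ) ≠ 0 := by exact_mod_cast hj
  refine ⟨Circle.exp (Real.pi / j), ?_⟩
  rw [← Circle.exp_intCast_mul, mul_div_cancel₀ _ hj']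
  exact Circle.exp_pi_ne_one

/-- Translating by `w` multiplies the integral by `w ^ j`; for `j ≠ 0` some `w` makes this factor
differ from `1`. -/
lemma integral_zpow_haarCircle (j : ℤ) :
    ∫ z : Circle, ((z ^ j : Circle) : ℂ) ∂haarCircle = if j = 0 then 1 else 0 := by
  split_ifs with hj
  · simp [hj]
  · obtain ⟨w, hw⟩ := exists_zpow_ne_one hj
    have h := integral_mul_left_eq_self (μ := haarCircle)
      (fun z : Circle => ((z ^ j : Circle) : ℂ)) w
    have h' : ((w ^ j : Circle) : ℂ) * ∫ z : Circle, ((z ^ j : Circle) : ℂ) ∂haarCircle =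
        ∫ z : Circle, ((z ^ j : Circle) : ℂ) ∂haarCircle := by
      rw [← integral_const_mul]
      refine Eq.trans (integral_congr_ae (ae_of_all _ fun z => ?_)) h
      simp only [mul_zpow, Circle.coe_mul]
    have hne : ((w ^ j : Circle) : ℂ) - 1 ≠ 0 := sub_ne_zero.2 fun h => hw (Circle.coe_eq_one.1 h)
    have : (((w ^ j : Circle) : ℂ) - 1) * ∫ z : Circle, ((z ^ j : Circle) : ℂ) ∂haarCircle = 0 := by
      rw [sub_mul, h', one_mul, sub_self]
    exact (mul_eq_zero.1 this).resolve_left hne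

/-- The proportion of pairs `k, l < N` with `k - l = j`, normalised by `N`. -/
noncomputable def fejerWeight (N : ℕ) (j : ℤ) : ℝ :=
  (N : ℝ)⁻¹ * ∑ k ∈ Finset.range N, ∑ l ∈ Finset.range N, if (k : ℤ) - l = j then 1 else 0

/-- The bound `1 - 2|j|/N` is crude but treats both signs of `j` at once: for `|j| ≤ k < N - |j|`
the index `l = k - j` lies in the range. -/
lemma tendsto_fejerWeight (j : ℤ) : Tendsto (fun N => fejerWeight N j) atTop (𝓝 1) := by
  have hin : ∀ N k : ℕ, ∑ l ∈ Finset.range N, (if (k : ℤ) - l = j then (1 : ℝ) else 0) ≤ 1 := by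
    intro N k
    rw [← Finset.sum_filter, Finset.sum_const, nsmul_eq_mul, mul_one]
    have : ((Finset.range N).filter fun l : ℕ => (k : ℤ) - l = j).card ≤ 1 := by
      refine Finset.card_le_one.2 fun a ha b hb => ?_
      simp only [Finset.mem_filter] at ha hb
      omega
    exact_mod_cast this
  have hone : ∀ N k : ℕ, j.natAbs ≤ k → k + j.natAbs < N →
      1 ≤ ∑ l ∈ Finset.range N, (if (k : ℤ) - l = j then (1 : ℝ) else 0) := by
    intro N k h1 h2
    have hmem : (k - j).toNat ∈ Finset.range N := by rw [Finset.mem_range]; omega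
    refine le_trans ?_ (Finset.single_le_sum (fun l _ => by split_ifs <;> simp) hmem)
    rw [if_pos (by omega)]
  have hup : ∀ N : ℕ, fejerWeight N j ≤ 1 := by
    intro N
    rcases Nat.eq_zero_or_pos N with rfl | hN
    · simp [fejerWeight]
    · have hN' : (0 : ℝ) < N := by exact_mod_cast hN
      rw [fejerWeight, inv_mul_le_iff₀ hN']
      refine (Finset.sum_le_sum fun k _ => hin N k).trans ?_
      simp
  have hlow : ∀ᶠ N : ℕ in atTop, 1 - 2 * (j.natAbs : ℝ) / N ≤ fejerWeight N j := by
    filter_upwards [eventually_gt_atTop (2 * j.natAbs)] with N hN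
    have hN' : (0 : ℝ) < N := by exact_mod_cast (Nat.zero_le _).trans_lt hN
    have hsub : Finset.Ico j.natAbs (N - j.natAbs) ⊆ Finset.range N := fun k hk => by
      simp only [Finset.mem_Ico, Finset.mem_range] at hk ⊢
      omega
    have hsum : ((N - j.natAbs - j.natAbs : ℕ) : ℝ) ≤ ∑ k ∈ Finset.range N,
        ∑ l ∈ Finset.range N, (if (k : ℤ) - l = j then (1 : ℝ) else 0) := by
      refine le_trans ?_ (Finset.sum_le_sum_of_subset_of_nonneg hsub fun k _ _ =>
        Finset.sum_nonneg fun l _ => by split_ifs <;> simp)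
      refine le_trans ?_ (Finset.sum_le_sum (f := fun _ => (1 : ℝ)) fun k hk => ?_)
      · simp
      · simp only [Finset.mem_Ico] at hk
        exact hone N k hk.1 (by omega)
    rw [fejerWeight, ← div_eq_inv_mul, le_div_iff₀ hN', sub_mul, one_mul,
      div_mul_cancel₀ _ hN'.ne']
    refine le_trans (le_of_eq ?_) hsum
    rw [Nat.cast_sub (by omega), Nat.cast_sub (by omega)]
    ring
  refine tendsto_of_tendsto_of_tendsto_of_le_of_le' ?_ tendsto_const_nhds hlow
    (Eventually.of_forall hup)
  simpa using (tendsto_const_div_atTop_nhds_zero_nat (2 * (j.natAbs : ℝ))).const_sub 1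

/-- This gives all Fejér measures with `N ≠ 0` the same total mass `φ 0`, so one constant normalises
them. -/
lemma fejerWeight_zero {N : ℕ} (hN : N ≠ 0) : fejerWeight N 0 = 1 := by
  have : ∀ k ∈ Finset.range N,
      ∑ l ∈ Finset.range N, (if (k : ℤ) - l = 0 then (1 : ℝ) else 0) = 1 := by
    intro k hk
    rw [Finset.sum_eq_single_of_mem k hk]
    · simp
    · intro l _ hlk
      rw [if_neg (by omega)]
  rw [fejerWeight, Finset.sum_congr rfl this]
  simp [hN]

section Stationary

variable {H : Type*} [NormedAddCommGroup H] [InnerProductSpace ℂ H]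

/-- The Fejér measures of a stationary sequence of vectors. -/
lemma exists_fejer_measure {g : ℤ → H} {φ : ℤ → ℂ}
    (hg : ∀ k l, inner ℂ (g l) (g k) = φ (k - l)) (N : ℕ) :
    ∃ σ : Measure Circle, IsFiniteMeasure σ ∧
      ∀ j, fourierCoefficient σ j = (fejerWeight N j : ℂ) * φ j := by
  -- The density `N⁻¹ ‖∑ z ^ (-k) g k‖²` is nonnegative and expands into terms `φ (k - l) z ^ (l -
  -- k)`; integrating against `z ^ j` keeps exactly those with `k - l = j`.
  let v : Circle → H := fun z => ∑ k ∈ Finset.range N, ((z ^ (-(k : ℤ)) : Circle) : ℂ) • g k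
  let F : Circle → ℝ := fun z => (N : ℝ)⁻¹ * ‖v z‖ ^ 2
  have hv : Continuous v :=
    continuous_finsetSum _ fun k _ => (continuous_coe_zpow _).smul continuous_const
  have hF : Continuous F := continuous_const.mul (hv.norm.pow 2)
  have hF0 : ∀ z, 0 ≤ F z := fun z => by positivity
  have hexp : ∀ z, (F z : ℂ) = (N : ℂ)⁻¹ * ∑ k ∈ Finset.range N, ∑ l ∈ Finset.range N,
      φ (k - l) * ((z ^ ((l : ℤ) - k) : Circle) : ℂ) := by
    intro z
    have h1 : ((‖v z‖ ^ 2 : ℝ) : ℂ) = inner ℂ (v z) (v z) := by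
      rw [inner_self_eq_norm_sq_to_K]; simp
    simp only [F, Complex.ofReal_mul, Complex.ofReal_inv, Complex.ofReal_natCast, h1]
    congr 1
    simp only [v]
    rw [inner_sum]
    refine Finset.sum_congr rfl fun k _ => ?_
    rw [sum_inner]
    refine Finset.sum_congr rfl fun l _ => ?_
    rw [inner_smul_left, inner_smul_right, hg, ← Circle.coe_inv_eq_conj, ← zpow_neg, neg_neg,
      ← mul_assoc, ← Circle.coe_mul, ← zpow_add, mul_comm, ← sub_eq_add_neg]
  have : IsFiniteMeasure (haarCircle.withDensity fun z => ENNReal.ofReal (F z)) :=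
    isFiniteMeasure_withDensity_ofReal (integrable_of_continuous hF _).2
  refine ⟨haarCircle.withDensity fun z => ENNReal.ofReal (F z), this, fun j => ?_⟩
  unfold fourierCoefficient
  rw [integral_withDensity_eq_integral_toReal_smul hF.measurable.ennreal_ofReal
    (ae_of_all _ fun _ => ENNReal.ofReal_lt_top)]
  have hpt : ∀ z : Circle, (ENNReal.ofReal (F z)).toReal • ((z ^ j : Circle) : ℂ) =
      (N : ℂ)⁻¹ * ∑ k ∈ Finset.range N, ∑ l ∈ Finset.range N,
        φ (k - l) * ((z ^ ((l : ℤ) - k + j) : Circle) : ℂ) := by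
    intro z
    rw [ENNReal.toReal_ofReal (hF0 z), Complex.real_smul, hexp, mul_assoc, Finset.sum_mul]
    congr 1
    refine Finset.sum_congr rfl fun k _ => ?_
    rw [Finset.sum_mul]
    refine Finset.sum_congr rfl fun l _ => ?_
    rw [mul_assoc, ← Circle.coe_mul, ← zpow_add]
  simp_rw [hpt]
  have hint : ∀ k l : ℕ, Integrable (fun z : Circle =>
      φ (k - l) * ((z ^ ((l : ℤ) - k + j) : Circle) : ℂ)) haarCircle := fun k l =>
    (integrable_of_continuous (continuous_coe_zpow _) _).const_mul _
  rw [integral_const_mul, integral_finsetSum _ fun k _ => integrable_finsetSum _ fun l _ => hint k l]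
  simp_rw [integral_finsetSum _ fun l _ => hint _ l, integral_const_mul, integral_zpow_haarCircle]
  simp only [fejerWeight, Complex.ofReal_mul, Complex.ofReal_inv, Complex.ofReal_natCast,
    Complex.ofReal_sum, mul_assoc, Finset.sum_mul]
  congr 1
  refine Finset.sum_congr rfl fun k _ => Finset.sum_congr rfl fun l _ => ?_
  by_cases h : (k : ℤ) - l = j
  · rw [if_pos (by omega), if_pos h, h]; simp
  · rw [if_neg (by omega), if_neg h]; simp

/-- **Herglotz' theorem**: the correlations of a stationary sequence of vectors are the Fourier
coefficients of a finite measure on the circle. -/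
theorem exists_spectral_measure {g : ℤ → H} {φ : ℤ → ℂ}
    (hg : ∀ k l, inner ℂ (g l) (g k) = φ (k - l)) :
    ∃ σ : Measure Circle, IsFiniteMeasure σ ∧ ∀ j, fourierCoefficient σ j = φ j := by
  choose σ hσ hφ using exists_fejer_measure hg
  have hmass : ∀ N, ((σ (N + 1)).real Set.univ : ℂ) = φ 0 := by
    intro N
    have h := hφ (N + 1) 0
    rw [fejerWeight_zero (Nat.succ_ne_zero N)] at h
    simpa [fourierCoefficient] using h
  set r : ℝ := (σ 1).real Set.univ
  have hr : ∀ N, (σ (N + 1)).real Set.univ = r := fun N => by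
    exact_mod_cast (hmass N).trans (hmass 0).symm
  have hlim : ∀ j, Tendsto (fun N => fourierCoefficient (σ (N + 1)) j) atTop (𝓝 (φ j)) := by
    intro j
    simp_rw [hφ]
    have h1 : Tendsto (fun N => (fejerWeight (N + 1) j : ℂ)) atTop (𝓝 ((1 : ℝ) : ℂ)) :=
      (Complex.continuous_ofReal.tendsto 1).comp
        ((tendsto_fejerWeight j).comp (tendsto_add_atTop_nat 1))
    simpa using h1.mul_const (φ j)
  rcases eq_or_ne r 0 with h0 | h0
  · refine ⟨0, inferInstance, fun j => tendsto_nhds_unique ?_ (hlim j)⟩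
    have hz : ∀ N, σ (N + 1) = 0 := fun N => by
      have := (hr N).trans h0
      rwa [measureReal_eq_zero_iff, Measure.measure_univ_eq_zero] at this
    simp_rw [hz]
    exact tendsto_const_nhds
  · have hr0 : ∀ N, (σ (N + 1)) Set.univ = ENNReal.ofReal r := fun N => by
      rw [← hr N, ofReal_measureReal]
    have hrpos : 0 < r := lt_of_le_of_ne measureReal_nonneg h0.symm
    let ν : ℕ → ProbabilityMeasure Circle := fun N => ⟨(ENNReal.ofReal r)⁻¹ • σ (N + 1), ⟨by
      rw [Measure.smul_apply, hr0, smul_eq_mul,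
        ENNReal.inv_mul_cancel (by simpa using hrpos) ENNReal.ofReal_ne_top]⟩⟩
    -- The coefficients already converge along `atTop`, so a limit along the hyperfilter suffices to
    -- identify them.
    obtain ⟨ν₀, hν₀⟩ := exists_tendsto_hyperfilter ν
    refine ⟨ENNReal.ofReal r • (ν₀ : Measure Circle), ?_, fun j => ?_⟩
    · exact Measure.smul_finite _ ENNReal.ofReal_ne_top
    · have h1 := ((continuous_fourierCoefficient j).tendsto ν₀).comp hν₀
      have h2 := (hlim j).mono_left Nat.hyperfilter_le_atTop
      have h3 : ∀ N, fourierCoefficient (σ (N + 1)) j =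
          (r : ℂ) * fourierCoefficient (ν N : Measure Circle) j := by
        intro N
        simp only [fourierCoefficient, ν, ProbabilityMeasure.coe_mk]
        rw [integral_smul_measure, ENNReal.toReal_inv, ENNReal.toReal_ofReal hrpos.le,
          Complex.real_smul, ← mul_assoc]
        have : (r : ℂ) * ((r⁻¹ : ℝ) : ℂ) = 1 := by exact_mod_cast mul_inv_cancel₀ h0
        rw [this, one_mul]
      have h4 := h1.const_mul (r : ℂ)
      have h5 : fourierCoefficient (ENNReal.ofReal r • (ν₀ : Measure Circle)) j =
          (r : ℂ) * fourierCoefficient (ν₀ : Measure Circle) j := by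
        simp only [fourierCoefficient]
        rw [integral_smul_measure, ENNReal.toReal_ofReal hrpos.le, Complex.real_smul]
      rw [h5]
      refine tendsto_nhds_unique h4 (h2.congr fun N => ?_)
      exact h3 N

end Stationary

/-! ### Characters of the infinite torus -/

/-- The character `x ↦ ∏ j, x j ^ p j` of the infinite torus. -/
noncomputable def torusChar (p : ℤ →₀ ℤ) (x : ℤ → Circle) : Circle := p.prod fun j c => x j ^ c

lemma torusChar_zero (x : ℤ → Circle) : torusChar 0 x = 1 := Finsupp.prod_zero_index

lemma torusChar_add (p q : ℤ →₀ ℤ) (x : ℤ → Circle) :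
    torusChar (p + q) x = torusChar p x * torusChar q x :=
  Finsupp.prod_add_index' (fun _ => zpow_zero _) fun _ _ _ => zpow_add _ _ _

lemma torusChar_neg (p : ℤ →₀ ℤ) (x : ℤ → Circle) : torusChar (-p) x = (torusChar p x)⁻¹ := by
  rw [eq_inv_iff_mul_eq_one, ← torusChar_add, neg_add_cancel, torusChar_zero]

lemma torusChar_single (j : ℤ) (x : ℤ → Circle) : torusChar (Finsupp.single j 1) x = x j := by
  simp [torusChar]

lemma continuous_torusChar (p : ℤ →₀ ℤ) : Continuous (torusChar p) :=
  continuous_finsetProd _ fun j _ => (continuous_apply j).zpow _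

/-- The characters of the infinite torus as continuous complex functions. -/
noncomputable def torusCharMap (p : ℤ →₀ ℤ) : C(ℤ → Circle, ℂ) :=
  ⟨fun x => (torusChar p x : ℂ), continuous_circle_coe.comp (continuous_torusChar p)⟩

@[simp] lemma torusCharMap_apply (p : ℤ →₀ ℤ) (x : ℤ → Circle) :
    torusCharMap p x = (torusChar p x : ℂ) := rfl

lemma star_torusCharMap (p : ℤ →₀ ℤ) : star (torusCharMap p) = torusCharMap (-p) := by
  ext x
  change (starRingEnd ℂ) (torusChar p x : ℂ) = (torusChar (-p) x : ℂ)
  rw [torusChar_neg, Circle.coe_inv_eq_conj]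

lemma torusCharMap_add (p q : ℤ →₀ ℤ) :
    torusCharMap (p + q) = torusCharMap p * torusCharMap q := by
  ext x
  simp [torusChar_add]

/-- The star algebra of trigonometric polynomials on the infinite torus. -/
noncomputable def torusAlgebra : StarSubalgebra ℂ C(ℤ → Circle, ℂ) where
  toSubalgebra := Algebra.adjoin ℂ (Set.range torusCharMap)
  star_mem' := by
    change Algebra.adjoin ℂ (Set.range torusCharMap) ≤
      star (Algebra.adjoin ℂ (Set.range torusCharMap))
    refine Algebra.adjoin_le ?_
    rintro _ ⟨p, rfl⟩
    refine Algebra.subset_adjoin ⟨-p, ?_⟩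
    exact (star_torusCharMap p).symm

/-- Characters are closed under products, so the algebra they generate is their linear span. This
turns Stone–Weierstrass into density of a span. -/
lemma torusAlgebra_toSubmodule :
    Subalgebra.toSubmodule torusAlgebra.toSubalgebra = Submodule.span ℂ (Set.range torusCharMap) := by
  refine Algebra.adjoin_eq_span_of_subset _ ?_
  refine Set.Subset.trans ?_ Submodule.subset_span
  intro f hf
  refine Submonoid.closure_induction (fun _ => id) ⟨0, ?_⟩ ?_ hf
  · ext x
    simp [torusChar_zero]
  · rintro _ _ _ _ ⟨p, rfl⟩ ⟨q, rfl⟩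
    exact ⟨p + q, torusCharMap_add p q⟩

/-- Trigonometric polynomials are uniformly dense in the continuous functions. -/
lemma dense_span_torusCharMap :
    Dense (Submodule.span ℂ (Set.range torusCharMap) : Set C(ℤ → Circle, ℂ)) := by
  have h : torusAlgebra.topologicalClosure = ⊤ := by
    refine ContinuousMap.starSubalgebra_topologicalClosure_eq_top_of_separatesPoints _ ?_
    intro x y hxy
    obtain ⟨j, hj⟩ := Function.ne_iff.1 hxy
    refine ⟨_, ⟨torusCharMap (Finsupp.single j 1), Algebra.subset_adjoin ⟨_, rfl⟩, rfl⟩, ?_⟩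
    simpa [torusChar_single] using fun h => hj (Circle.ext h)
  rw [← torusAlgebra_toSubmodule]
  intro f
  have : f ∈ torusAlgebra.topologicalClosure := h ▸ trivial
  exact this

/-- A probability measure on the infinite torus is determined by its Fourier coefficients. -/
lemma eq_of_integral_torusChar_eq {m m' : ProbabilityMeasure (ℤ → Circle)}
    (h : ∀ p, ∫ x, (torusChar p x : ℂ) ∂(m : Measure (ℤ → Circle)) =
      ∫ x, (torusChar p x : ℂ) ∂(m' : Measure (ℤ → Circle))) : m = m' := by
  let I : ProbabilityMeasure (ℤ → Circle) → C(ℤ → Circle, ℂ) →L[ℂ] ℂ := fun μ =>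
    LinearMap.mkContinuous
      { toFun := fun f => ∫ x, f x ∂(μ : Measure (ℤ → Circle))
        map_add' := fun f g => integral_add (integrable_of_continuous f.continuous _)
          (integrable_of_continuous g.continuous _)
        map_smul' := fun c f => integral_const_mul c _ } 1 fun f => by
      rw [one_mul]
      refine (norm_integral_le_of_norm_le_const (ae_of_all _ f.norm_coe_le_norm)).trans ?_
      simp
  have hI : I m = I m' := by
    refine ContinuousLinearMap.ext_on dense_span_torusCharMap ?_
    rintro _ ⟨p, rfl⟩
    exact h p
  apply Subtype.ext
  change (m : Measure (ℤ → Circle)) = m'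
  refine ext_of_forall_integral_eq_of_IsFiniteMeasure fun f => ?_
  have h1 := congrArg (fun L : C(ℤ → Circle, ℂ) →L[ℂ] ℂ =>
    L ⟨fun x => (f x : ℂ), Complex.continuous_ofReal.comp f.continuous⟩) hI
  have h2 : ∫ x, (f x : ℂ) ∂(m : Measure (ℤ → Circle)) =
      ∫ x, (f x : ℂ) ∂(m' : Measure (ℤ → Circle)) := h1
  rw [integral_complex_ofReal, integral_complex_ofReal] at h2
  exact_mod_cast h2

/-! ### Gaussian measures with prescribed spectral measure -/

/-- The trigonometric polynomial `∑ j, p j * z ^ j` on the circle. -/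
noncomputable def trigPoly (p : ℤ →₀ ℤ) (z : Circle) : ℂ :=
  p.sum fun j c => (c : ℂ) * ((z ^ j : Circle) : ℂ)

lemma continuous_trigPoly (p : ℤ →₀ ℤ) : Continuous (trigPoly p) :=
  continuous_finsetSum _ fun _ _ => continuous_const.mul (continuous_coe_zpow _)

lemma trigPoly_add (p q : ℤ →₀ ℤ) (z : Circle) :
    trigPoly (p + q) z = trigPoly p z + trigPoly q z :=
  Finsupp.sum_add_index' (by simp) (by intros; push_cast; ring)

lemma trigPoly_neg (p : ℤ →₀ ℤ) (z : Circle) : trigPoly (-p) z = -trigPoly p z := by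
  rw [eq_neg_iff_add_eq_zero, ← trigPoly_add, neg_add_cancel]
  simp [trigPoly]

/-- `m` has the Fourier coefficients of the process `(exp (i X_j))`, where `(X_j)` is the
stationary Gaussian process with spectral measure `σ`. -/
def IsGaussianTorusMeasure (σ : ProbabilityMeasure Circle)
    (m : ProbabilityMeasure (ℤ → Circle)) : Prop :=
  ∀ p, ∫ x, (torusChar p x : ℂ) ∂(m : Measure (ℤ → Circle)) =
    (Real.exp (-(1 / 2) * ∫ z, ‖trigPoly p z‖ ^ 2 ∂(σ : Measure Circle)) : ℂ)

lemma integral_cexp_gaussian {κ : Type*} [Fintype κ] (d : κ → ℝ) :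
    ∫ ω : κ → ℝ, (Circle.exp (∑ k, d k * ω k) : ℂ)
      ∂(Measure.pi fun _ => ProbabilityTheory.gaussianReal 0 1) =
      (Real.exp (-(1 / 2) * ∑ k, d k ^ 2) : ℂ) := by
  have h1 : ∀ ω : κ → ℝ, (Circle.exp (∑ k, d k * ω k) : ℂ) =
      ∏ k, Complex.exp (d k * ω k * Complex.I) := by
    intro ω
    rw [Circle.coe_exp, ← Complex.exp_sum, ← Finset.sum_mul]
    push_cast
    rfl
  simp_rw [h1]
  rw [integral_fintype_prod_eq_prod fun k (t : ℝ) => Complex.exp (d k * t * Complex.I)]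
  simp_rw [← charFun_apply_real, ProbabilityTheory.charFun_gaussianReal]
  rw [← Complex.exp_sum, Complex.ofReal_exp, Finset.mul_sum]
  push_cast
  congr 1
  refine Finset.sum_congr rfl fun k _ => ?_
  ring

/-- For `σ = ∑ a_i δ_{z_i}` the process is explicit: `X_j = ∑ √a_i (Re(z_i ^ j) ξ_i + Im(z_i ^ j)
η_i)` with independent standard Gaussians. Then `∑ p_j X_j` has variance `∑ a_i |P(z_i)|²`, where
`P` is `trigPoly p`. -/
lemma exists_gaussianTorusMeasure_mix (F : Finset Circle) (a : F → ℝ≥0) (ha : ∑ i, a i = 1) :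
    ∃ m, IsGaussianTorusMeasure (mix a ha fun i => diracProba (i : Circle)) m := by
  let P : Measure (F × Bool → ℝ) := Measure.pi fun _ => ProbabilityTheory.gaussianReal 0 1
  let c : F × Bool → ℂ → ℝ := fun k w => √(a k.1) * if k.2 then w.re else w.im
  let X : (F × Bool → ℝ) → ℤ → ℝ := fun ω j =>
    ∑ k, c k ((((k.1 : Circle) ^ j : Circle) : ℂ)) * ω k
  have hcsum : ∀ k (p : ℤ →₀ ℤ),
      ∑ j ∈ p.support, (p j : ℝ) * c k ((((k.1 : Circle) ^ j : Circle) : ℂ)) =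
        c k (trigPoly p k.1) := by
    rintro ⟨z, b⟩ p
    cases b <;>
      simp [c, trigPoly, Finsupp.sum, Finset.mul_sum, mul_left_comm, Complex.re_sum,
        Complex.im_sum]
  have hX : Continuous fun ω j => Circle.exp (X ω j) :=
    continuous_pi fun j => Circle.exp.continuous.comp
      (continuous_finsetSum _ fun k _ => continuous_const.mul (continuous_apply k))
  have hchar : ∀ (p : ℤ →₀ ℤ) ω, torusChar p (fun j => Circle.exp (X ω j)) =
      Circle.exp (∑ k, c k (trigPoly p k.1) * ω k) := by
    intro p ω
    have h1 : ∑ k, c k (trigPoly p k.1) * ω k = ∑ j ∈ p.support, (p j : ℝ) * X ω j := by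
      simp_rw [← hcsum, Finset.sum_mul, X, Finset.mul_sum]
      rw [Finset.sum_comm]
      simp_rw [mul_assoc]
    rw [h1]
    have h2 : ∀ s : Finset ℤ, Circle.exp (∑ j ∈ s, (p j : ℝ) * X ω j) =
        ∏ j ∈ s, Circle.exp (X ω j) ^ p j := by
      intro s
      induction s using Finset.cons_induction with
      | empty => simp
      | cons j s hj ih => rw [Finset.sum_cons, Finset.prod_cons, Circle.exp_add, ih,
          Circle.exp_intCast_mul]
    rw [h2]
    rfl
  let P' : ProbabilityMeasure (F × Bool → ℝ) := ⟨P, inferInstance⟩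
  refine ⟨P'.map hX.measurable.aemeasurable, fun p => ?_⟩
  refine (integral_map (μ := P) hX.measurable.aemeasurable
    (continuous_circle_coe.comp (continuous_torusChar p)).aestronglyMeasurable).trans ?_
  simp only [Function.comp_apply, hchar]
  refine (integral_cexp_gaussian fun k => c k (trigPoly p k.1)).trans ?_
  congr 3
  rw [integral_mix a ha (f := fun z => ‖trigPoly p z‖ ^ 2) _ fun i =>
    integrable_of_continuous ((continuous_trigPoly p).norm.pow 2) _]
  rw [Fintype.sum_prod_type]
  refine Finset.sum_congr rfl fun i _ => ?_
  have hd : ∫ z, ‖trigPoly p z‖ ^ 2 ∂(diracProba (i : Circle) : Measure Circle) =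
      ‖trigPoly p i‖ ^ 2 := integral_dirac _ _
  rw [hd, ← Complex.normSq_eq_norm_sq, Complex.normSq_apply]
  have hs : √(a i : ℝ) ^ 2 = a i := Real.sq_sqrt (a i).2
  simp only [c, Fintype.sum_bool, if_true, Bool.false_eq_true, if_false, mul_pow, hs, smul_eq_mul]
  ring

/-- Every probability measure on the circle is the spectral measure of a stationary Gaussian
process, encoded here by its exponential on the infinite torus. -/
theorem exists_gaussianTorusMeasure (σ : ProbabilityMeasure Circle) :
    ∃ m, IsGaussianTorusMeasure σ m := by
  obtain ⟨u, hu, huσ⟩ := mem_closure_iff_ultrafilter.1 (mem_closure_mix_diracProba dense_univ σ)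
  have hex : ∀ τ : ProbabilityMeasure Circle, ∃ m, (∃ (F : Finset Circle) (a : F → ℝ≥0)
      (ha : ∑ i, a i = 1), (∀ z ∈ F, z ∈ Set.univ) ∧ τ = mix a ha fun i => diracProba (i : Circle)) →
      IsGaussianTorusMeasure τ m := by
    intro τ
    by_cases h : ∃ (F : Finset Circle) (a : F → ℝ≥0) (ha : ∑ i, a i = 1),
      (∀ z ∈ F, z ∈ Set.univ) ∧ τ = mix a ha fun i => diracProba (i : Circle)
    · obtain ⟨F, a, ha, -, rfl⟩ := h
      exact (exists_gaussianTorusMeasure_mix F a ha).imp fun m hm _ => hm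
    · exact ⟨diracProba 1, fun h' => absurd h' h⟩
  choose G hG using hex
  -- Compactness gives a limit of the measures built for finitely supported approximations of `σ`.
  -- Both sides of the defining identity are weakly continuous, so it passes to the limit.
  obtain ⟨m, -, hm⟩ := isCompact_univ.ultrafilter_le_nhds (u.map G) (by simp)
  refine ⟨m, fun p => ?_⟩
  have h1 : Tendsto (fun τ => ∫ x, (torusChar p x : ℂ) ∂(G τ : Measure (ℤ → Circle))) u
      (𝓝 (∫ x, (torusChar p x : ℂ) ∂(m : Measure (ℤ → Circle)))) :=
    ((continuous_integral_complex
      (continuous_circle_coe.comp (continuous_torusChar p))).tendsto m).comp hm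
  have h2 : Tendsto (fun τ : ProbabilityMeasure Circle =>
      (Real.exp (-(1 / 2) * ∫ z, ‖trigPoly p z‖ ^ 2 ∂(τ : Measure Circle)) : ℂ)) u
      (𝓝 (Real.exp (-(1 / 2) * ∫ z, ‖trigPoly p z‖ ^ 2 ∂(σ : Measure Circle)) : ℂ)) := by
    have h3 := tendsto_probabilityMeasure_iff.1
      ((tendsto_id (α := ProbabilityMeasure Circle)).mono_left huσ) _
      ((continuous_trigPoly p).norm.pow 2)
    exact (Complex.continuous_ofReal.tendsto _).comp
      ((Real.continuous_exp.tendsto _).comp (h3.const_mul _))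
  refine tendsto_nhds_unique h1 (h2.congr' ?_)
  filter_upwards [hu] with τ hτ
  exact (hG τ hτ p).symm

/-! ### Approximation from a dense span, and Wiener's lemma -/

section Hilbert

/-- Uniformly bounded operators tending to zero on a set with dense span tend to zero
everywhere. -/
lemma tendsto_zero_of_dense_span {V W : Type*} [NormedAddCommGroup V] [NormedSpace ℂ V]
    [NormedAddCommGroup W] [NormedSpace ℂ W] (A : ℕ → V →L[ℂ] W) {C : ℝ}
    (hC : ∀ N v, ‖A N v‖ ≤ C * ‖v‖) {S : Set V} (hS : Dense (Submodule.span ℂ S : Set V))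
    (h : ∀ s ∈ S, Tendsto (fun N => A N s) atTop (𝓝 0)) (v : V) :
    Tendsto (fun N => A N v) atTop (𝓝 0) := by
  have hspan : ∀ w ∈ Submodule.span ℂ S, Tendsto (fun N => A N w) atTop (𝓝 0) := by
    intro w hw
    induction hw using Submodule.span_induction with
    | mem w hw => exact h w hw
    | zero => simp
    | add u w _ _ hu hw => simpa using hu.add hw
    | smul c w _ hw => simpa using hw.const_smul c
  have hC0 : 0 < |C| + 1 := by positivity
  rw [Metric.tendsto_atTop]
  intro ε hε
  obtain ⟨w, hw, hvw⟩ := Metric.mem_closure_iff.1 (hS v) (ε / 2 / (|C| + 1)) (by positivity)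
  obtain ⟨N₀, hN₀⟩ := Metric.tendsto_atTop.1 (hspan w hw) (ε / 2) (half_pos hε)
  refine ⟨N₀, fun N hN => ?_⟩
  have h1 : ‖A N w‖ < ε / 2 := by simpa using hN₀ N hN
  have h2 : ‖A N (v - w)‖ < ε / 2 := by
    calc ‖A N (v - w)‖ ≤ C * ‖v - w‖ := hC N _
      _ ≤ (|C| + 1) * ‖v - w‖ := by
          gcongr
          exact (le_abs_self C).trans (by linarith)
      _ < (|C| + 1) * (ε / 2 / (|C| + 1)) := by
          rw [dist_eq_norm] at hvw
          gcongr
      _ = ε / 2 := by field_simp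
  rw [dist_zero_right]
  calc ‖A N v‖ = ‖A N (v - w) + A N w‖ := by rw [← map_add, sub_add_cancel]
    _ ≤ ‖A N (v - w)‖ + ‖A N w‖ := norm_add_le _ _
    _ < ε := by linarith

end Hilbert

section Wiener

/-- The average of the first `N` powers of a point of the circle. -/
noncomputable def powerMean (N : ℕ) (u : Circle) : ℂ :=
  (N : ℂ)⁻¹ * ∑ j ∈ Finset.range N, ((u ^ (j : ℤ) : Circle) : ℂ)

lemma continuous_powerMean (N : ℕ) : Continuous (powerMean N) :=
  continuous_const.mul (continuous_finsetSum _ fun j _ => continuous_coe_zpow j)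

lemma norm_powerMean_le (N : ℕ) (u : Circle) : ‖powerMean N u‖ ≤ 1 := by
  have h : ‖∑ j ∈ Finset.range N, ((u ^ (j : ℤ) : Circle) : ℂ)‖ ≤ N := by
    refine (norm_sum_le _ _).trans ?_
    simp_rw [Circle.norm_coe]
    simp
  rw [powerMean, norm_mul, norm_inv, Complex.norm_natCast]
  rcases Nat.eq_zero_or_pos N with rfl | hN
  · simp
  · rw [inv_mul_le_iff₀ (by exact_mod_cast hN), mul_one]
    exact h

lemma tendsto_powerMean_of_ne_one {u : Circle} (hu : u ≠ 1) :
    Tendsto (fun N => powerMean N u) atTop (𝓝 0) := by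
  have hu' : (u : ℂ) ≠ 1 := fun h => hu (Circle.coe_eq_one.1 h)
  have hpos : 0 < ‖(u : ℂ) - 1‖ := norm_pos_iff.2 (sub_ne_zero.2 hu')
  refine squeeze_zero_norm (a := fun N : ℕ => 2 / ‖(u : ℂ) - 1‖ / N) (fun N => ?_)
    (tendsto_const_div_atTop_nhds_zero_nat _)
  have h : powerMean N u = (N : ℂ)⁻¹ * (((u : ℂ) ^ N - 1) / ((u : ℂ) - 1)) := by
    rw [← geom_sum_eq hu']
    simp [powerMean]
  rw [h, norm_mul, norm_inv, Complex.norm_natCast, norm_div, ← div_eq_inv_mul]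
  gcongr
  calc ‖(u : ℂ) ^ N - 1‖ ≤ ‖(u : ℂ) ^ N‖ + ‖(1 : ℂ)‖ := norm_sub_le _ _
    _ = 2 := by rw [norm_pow, Circle.norm_coe]; norm_num

lemma powerMean_one {N : ℕ} (hN : N ≠ 0) : powerMean N 1 = 1 := by
  have : (N : ℂ) ≠ 0 := by exact_mod_cast hN
  simp [powerMean, this]

/-- The mass of an atom is a limit of averages of Fourier coefficients. -/
lemma tendsto_average_fourierCoefficient (σ : Measure Circle) [IsFiniteMeasure σ] (z : Circle) :
    Tendsto (fun N : ℕ => (N : ℂ)⁻¹ * ∑ j ∈ Finset.range N,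
      ((z ^ (-(j : ℤ)) : Circle) : ℂ) * fourierCoefficient σ j) atTop (𝓝 (σ.real {z} : ℂ)) := by
  -- The average is the integral of `powerMean N (w * z⁻¹)`, which converges boundedly to the
  -- indicator of `{z}`.
  have h1 : ∀ N : ℕ, (N : ℂ)⁻¹ * ∑ j ∈ Finset.range N,
      ((z ^ (-(j : ℤ)) : Circle) : ℂ) * fourierCoefficient σ j =
        ∫ w, powerMean N (w * z⁻¹) ∂σ := by
    intro N
    simp only [powerMean, fourierCoefficient]
    rw [integral_const_mul, integral_finsetSum]
    · simp_rw [← integral_const_mul]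
      congr 1
      refine Finset.sum_congr rfl fun j _ => integral_congr_ae (ae_of_all _ fun w => ?_)
      simp only [mul_zpow, inv_zpow, zpow_neg, Circle.coe_mul]
      ring
    · exact fun j _ => integrable_of_continuous
        ((continuous_coe_zpow j).comp (continuous_mul_const _)) _
  simp_rw [h1]
  have h2 : (σ.real {z} : ℂ) = ∫ w, Set.indicator {z} (fun _ => (1 : ℂ)) w ∂σ := by
    rw [integral_indicator (measurableSet_singleton z)]
    simp [Measure.real]
  rw [h2]
  refine tendsto_integral_of_dominated_convergence (fun _ => 1)
    (fun N => ((continuous_powerMean N).comp (continuous_mul_const _)).aestronglyMeasurable)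
    (integrable_const _) (fun N => ae_of_all _ fun w => norm_powerMean_le _ _)
    (ae_of_all _ fun w => ?_)
  by_cases hw : w = z
  · subst hw
    rw [Set.indicator_of_mem (Set.mem_singleton w), mul_inv_cancel]
    refine tendsto_const_nhds.congr' ?_
    filter_upwards [eventually_ne_atTop 0] with N hN
    rw [powerMean_one hN]
  · rw [Set.indicator_of_notMem (by simpa using hw)]
    exact tendsto_powerMean_of_ne_one fun h => hw (mul_inv_eq_one.1 h)

/-- **Wiener's lemma** for a continuous density against an atomless measure. -/
lemma tendsto_average_norm_integral (σ : Measure Circle) [IsFiniteMeasure σ]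
    (hc : ∀ z, σ {z} = 0) {h : Circle → ℂ} (hh : Continuous h) :
    Tendsto (fun N : ℕ => (N : ℝ)⁻¹ * ∑ j ∈ Finset.range N,
      ‖∫ z, ((z ^ (j : ℤ) : Circle) : ℂ) * h z ∂σ‖) atTop (𝓝 0) := by
  obtain ⟨C, hC⟩ := (isCompact_range hh).isBounded.exists_norm_le
  have hC' : ∀ z, ‖h z‖ ≤ C := fun z => hC _ ⟨z, rfl⟩
  -- By Fubini the mean of the squared norms is `∫ G N` over `σ × σ`. It vanishes in the limit off
  -- the diagonal, which is null as `σ` is atomless.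
  let G : ℕ → Circle × Circle → ℂ := fun N p =>
    h p.1 * (starRingEnd ℂ) (h p.2) * powerMean N (p.1 * p.2⁻¹)
  have hsq : ∀ N : ℕ, (((N : ℝ)⁻¹ * ∑ j ∈ Finset.range N,
      ‖∫ z, ((z ^ (j : ℤ) : Circle) : ℂ) * h z ∂σ‖ ^ 2 : ℝ) : ℂ) =
        ∫ p, G N p ∂(σ.prod σ) := by
    intro N
    have hterm : ∀ j : ℕ, ((‖∫ z, ((z ^ (j : ℤ) : Circle) : ℂ) * h z ∂σ‖ ^ 2 : ℝ) : ℂ) =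
        ∫ p : Circle × Circle, (((p.1 ^ (j : ℤ) : Circle) : ℂ) * h p.1) *
          (starRingEnd ℂ) (((p.2 ^ (j : ℤ) : Circle) : ℂ) * h p.2) ∂(σ.prod σ) := by
      intro j
      rw [integral_prod_mul (fun z : Circle => ((z ^ (j : ℤ) : Circle) : ℂ) * h z)
        (fun w : Circle => (starRingEnd ℂ) (((w ^ (j : ℤ) : Circle) : ℂ) * h w)), integral_conj,
        Complex.mul_conj, Complex.normSq_eq_norm_sq]
    have hG : ∀ p, G N p = (N : ℂ)⁻¹ * ∑ j ∈ Finset.range N,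
        (((p.1 ^ (j : ℤ) : Circle) : ℂ) * h p.1) *
          (starRingEnd ℂ) (((p.2 ^ (j : ℤ) : Circle) : ℂ) * h p.2) := by
      intro p
      simp only [G, powerMean]
      rw [mul_left_comm, Finset.mul_sum]
      congr 1
      refine Finset.sum_congr rfl fun j _ => ?_
      rw [mul_zpow, inv_zpow, Circle.coe_mul, Circle.coe_inv_eq_conj, map_mul]
      ring
    simp_rw [hG]
    rw [integral_const_mul, integral_finsetSum]
    · simp_rw [← hterm]
      push_cast
      rfl
    · intro j _
      refine integrable_of_continuous ?_ _
      have h1 : Continuous fun z : Circle => ((z ^ (j : ℤ) : Circle) : ℂ) * h z :=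
        (continuous_coe_zpow j).mul hh
      exact (h1.comp continuous_fst).mul (Complex.continuous_conj.comp (h1.comp continuous_snd))
  have hlim : Tendsto (fun N => ∫ p, G N p ∂(σ.prod σ)) atTop (𝓝 0) := by
    have h0 : (0 : ℂ) = ∫ p : Circle × Circle, (0 : ℂ) ∂(σ.prod σ) := by simp
    rw [h0]
    refine tendsto_integral_of_dominated_convergence (fun _ => C * C)
      (fun N => ?_) (integrable_const _) (fun N => ae_of_all _ fun p => ?_) ?_
    · refine Continuous.aestronglyMeasurable ?_
      exact ((hh.comp continuous_fst).mul (Complex.continuous_conj.comp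
        (hh.comp continuous_snd))).mul ((continuous_powerMean N).comp
          (continuous_fst.mul continuous_snd.inv))
    · calc ‖G N p‖ = ‖h p.1‖ * ‖h p.2‖ * ‖powerMean N (p.1 * p.2⁻¹)‖ := by
            simp only [G, norm_mul, RCLike.norm_conj]
        _ ≤ C * C * 1 := by
            have hC0 : 0 ≤ C := (norm_nonneg _).trans (hC' 1)
            gcongr
            exacts [hC' _, hC' _, norm_powerMean_le _ _]
        _ = C * C := mul_one _
    · have hdiag : (σ.prod σ) (Set.diagonal Circle) = 0 := by
        rw [Measure.measure_prod_null measurableSet_diagonal]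
        refine ae_of_all _ fun z => ?_
        have : Prod.mk z ⁻¹' Set.diagonal Circle = {z} := by
          ext w
          simp [eq_comm]
        simp only [this, hc, Pi.zero_apply]
      filter_upwards [measure_eq_zero_iff_ae_notMem.1 hdiag] with p hp
      have hne : p.1 * p.2⁻¹ ≠ 1 := fun h => hp (mul_inv_eq_one.1 h)
      simpa [G] using (tendsto_powerMean_of_ne_one hne).const_mul
        (h p.1 * (starRingEnd ℂ) (h p.2))
  have hlim' : Tendsto (fun N : ℕ => (N : ℝ)⁻¹ * ∑ j ∈ Finset.range N,
      ‖∫ z, ((z ^ (j : ℤ) : Circle) : ℂ) * h z ∂σ‖ ^ 2) atTop (𝓝 0) := by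
    refine ((Complex.continuous_re.tendsto 0).comp hlim).congr fun N => ?_
    rw [Function.comp_apply, ← hsq, Complex.ofReal_re]
  have hsqrt := hlim'.sqrt
  rw [Real.sqrt_zero] at hsqrt
  refine squeeze_zero (fun N => by positivity) (fun N => ?_) hsqrt
  refine Real.le_sqrt_of_sq_le ?_
  rcases Nat.eq_zero_or_pos N with rfl | hN
  · simp
  have hN' : (0 : ℝ) < N := by exact_mod_cast hN
  -- Cauchy–Schwarz passes from the mean of squares to the mean of norms.
  have hcs := sq_sum_le_card_mul_sum_sq (s := Finset.range N)
    (f := fun j : ℕ => ‖∫ z, ((z ^ (j : ℤ) : Circle) : ℂ) * h z ∂σ‖)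
  rw [Finset.card_range] at hcs
  rw [mul_pow, sq, mul_assoc]
  refine mul_le_mul_of_nonneg_left ?_ (by positivity)
  rwa [inv_mul_le_iff₀ hN']

end Wiener

/-! ### Koopman operators: criteria for weak mixing and rigidity -/

section Koopman

variable {X : Type*} [MeasurableSpace X] {m : Measure X} {T : X ≃ᵐ X}

lemma iter_add (T : X ≃ᵐ X) (a b : ℤ) (x : X) : iter T (a + b) x = iter T a (iter T b x) := by
  simp [iter, zpow_add]

/-- The Koopman operators `f ↦ f ∘ T ^ j` on `L²`. -/
noncomputable def koopman (hT : ∀ j, MeasurePreserving (iter T j) m m) (j : ℤ) :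
    Lp ℂ 2 m →ₗᵢ[ℂ] Lp ℂ 2 m :=
  Lp.compMeasurePreservingₗᵢ ℂ (iter T j) (hT j)

lemma coeFn_koopman (hT : ∀ j, MeasurePreserving (iter T j) m m) (j : ℤ) (F : Lp ℂ 2 m) :
    koopman hT j F =ᵐ[m] F ∘ iter T j :=
  Lp.coeFn_compMeasurePreserving F (hT j)

lemma koopman_add (hT : ∀ j, MeasurePreserving (iter T j) m m) (a b : ℤ) (F : Lp ℂ 2 m) :
    koopman hT (a + b) F = koopman hT b (koopman hT a F) := by
  apply Lp.ext
  refine (coeFn_koopman hT _ _).trans ?_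
  refine EventuallyEq.trans ?_ (coeFn_koopman hT b (koopman hT a F)).symm
  refine EventuallyEq.trans ?_
    ((hT b).quasiMeasurePreserving.ae_eq_comp (coeFn_koopman hT a F)).symm
  exact ae_of_all _ fun x => by simp [iter_add]

/-- This stationarity of `j ↦ U ^ j F` is the hypothesis of Herglotz' theorem. -/
lemma inner_koopman_koopman (hT : ∀ j, MeasurePreserving (iter T j) m m) (k l : ℤ)
    (F : Lp ℂ 2 m) :
    inner ℂ (koopman hT l F) (koopman hT k F) = inner ℂ F (koopman hT (k - l) F) := by
  rw [show koopman hT k F = koopman hT l (koopman hT (k - l) F) by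
    rw [← koopman_add, sub_add_cancel]]
  exact (koopman hT l).inner_map_map _ _

lemma inner_toLp_koopman (hT : ∀ j, MeasurePreserving (iter T j) m m) {f : X → ℂ}
    (hf : MemLp f 2 m) (j : ℤ) :
    inner ℂ (hf.toLp f) (koopman hT j (hf.toLp f)) =
      ∫ x, f (iter T j x) * (starRingEnd ℂ) (f x) ∂m := by
  rw [L2.inner_def]
  refine integral_congr_ae ?_
  filter_upwards [hf.coeFn_toLp, coeFn_koopman hT j (hf.toLp f),
    (hT j).quasiMeasurePreserving.ae_eq_comp hf.coeFn_toLp] with x h1 h2 h3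
  simp only [Function.comp_apply] at h2 h3
  rw [h1, h2, h3, RCLike.inner_apply]

/-- Every `L²` function has a spectral measure. -/
lemma exists_isSpectralMeasure (hT : ∀ j, MeasurePreserving (iter T j) m m) {f : X → ℂ}
    (hf : MemLp f 2 m) : ∃ σ, IsSpectralMeasure m T f σ := by
  obtain ⟨σ, hσ, h⟩ := exists_spectral_measure (g := fun j => koopman hT j (hf.toLp f))
    (φ := fun j => inner ℂ (hf.toLp f) (koopman hT j (hf.toLp f)))
    (fun k l => inner_koopman_koopman hT k l (hf.toLp f))
  exact ⟨σ, hσ, fun j => (h j).trans (inner_toLp_koopman hT hf j)⟩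

variable [IsProbabilityMeasure m]

/-- The constant function `1` in `L²`. -/
noncomputable def oneLp (m : Measure X) [IsProbabilityMeasure m] : Lp ℂ 2 m :=
  (memLp_const 1).toLp fun _ => 1

lemma norm_oneLp : ‖oneLp m‖ = 1 := by
  rw [oneLp, Lp.norm_toLp, eLpNorm_const _ (by simp) (NeZero.ne m)]
  simp

lemma inner_oneLp {f : X → ℂ} (hf : MemLp f 2 m) :
    inner ℂ (oneLp m) (hf.toLp f) = ∫ x, f x ∂m := by
  rw [L2.inner_def]
  refine integral_congr_ae ?_
  filter_upwards [hf.coeFn_toLp, (memLp_const (μ := m) (p := 2) (1 : ℂ)).coeFn_toLp] with x h1 h2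
  rw [oneLp, h1, h2, RCLike.inner_apply]
  simp

/-- The twisted ergodic averages `N⁻¹ ∑ z ^ (-j) (U ^ j - E)`, where `E` is the expectation. -/
noncomputable def twistedAverage (hT : ∀ j, MeasurePreserving (iter T j) m m) (z : Circle)
    (N : ℕ) : Lp ℂ 2 m →L[ℂ] Lp ℂ 2 m :=
  (N : ℂ)⁻¹ • ∑ j ∈ Finset.range N, ((z ^ (-(j : ℤ)) : Circle) : ℂ) •
    ((koopman hT j).toContinuousLinearMap - (innerSL ℂ (oneLp m)).smulRight (oneLp m))

lemma twistedAverage_apply (hT : ∀ j, MeasurePreserving (iter T j) m m) (z : Circle) (N : ℕ)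
    (F : Lp ℂ 2 m) : twistedAverage hT z N F =
      (N : ℂ)⁻¹ • ∑ j ∈ Finset.range N, ((z ^ (-(j : ℤ)) : Circle) : ℂ) •
        (koopman hT j F - inner ℂ (oneLp m) F • oneLp m) := by
  simp [twistedAverage]

lemma norm_twistedAverage_le (hT : ∀ j, MeasurePreserving (iter T j) m m) (z : Circle) (N : ℕ)
    (F : Lp ℂ 2 m) : ‖twistedAverage hT z N F‖ ≤ 2 * ‖F‖ := by
  rw [twistedAverage_apply, norm_smul, norm_inv, Complex.norm_natCast]
  rcases Nat.eq_zero_or_pos N with rfl | hN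
  · simp
  rw [inv_mul_le_iff₀ (by exact_mod_cast hN)]
  refine (norm_sum_le _ _).trans ?_
  have hterm : ∀ j ∈ Finset.range N, ‖((z ^ (-(j : ℤ)) : Circle) : ℂ) •
      (koopman hT j F - inner ℂ (oneLp m) F • oneLp m)‖ ≤ 2 * ‖F‖ := by
    intro j _
    rw [norm_smul, Circle.norm_coe, one_mul]
    refine (norm_sub_le _ _).trans ?_
    rw [LinearIsometry.norm_map, norm_smul, norm_oneLp, mul_one]
    have := norm_inner_le_norm (𝕜 := ℂ) (oneLp m) F
    rw [norm_oneLp, one_mul] at this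
    linarith
  refine (Finset.sum_le_sum hterm).trans ?_
  simp

/-- Weak mixing follows from the weak convergence to `0` of twisted averages on a set with dense
span. -/
lemma isWeaklyMixing_of_tendsto (hT : ∀ j, MeasurePreserving (iter T j) m m)
    {S : Set (Lp ℂ 2 m)} (hS : Dense (Submodule.span ℂ S : Set (Lp ℂ 2 m)))
    (h : ∀ z : Circle, ∀ F ∈ S, ∀ G ∈ S,
      Tendsto (fun N => inner ℂ G (twistedAverage hT z N F)) atTop (𝓝 0)) :
    IsWeaklyMixing m T := by
  intro f hf hf0
  obtain ⟨σ, hσ⟩ := exists_isSpectralMeasure hT hf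
  refine ⟨σ, hσ, fun z => ?_⟩
  have := hσ.1
  -- Density is used once in each argument of the inner product, with a conjugation in between so
  -- that the varying argument is always the linear one.
  have h1 : ∀ G ∈ S, ∀ F, Tendsto (fun N => inner ℂ G (twistedAverage hT z N F)) atTop (𝓝 0) := by
    intro G hG
    refine tendsto_zero_of_dense_span (fun N => (innerSL ℂ G).comp (twistedAverage hT z N))
      (C := ‖G‖ * 2) (fun N F => ?_) hS fun F hF => h z F hF G hG
    refine (norm_inner_le_norm (𝕜 := ℂ) G _).trans ?_
    rw [mul_assoc]
    exact mul_le_mul_of_nonneg_left (norm_twistedAverage_le hT z N F) (norm_nonneg _)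
  have h2 : ∀ F G, Tendsto (fun N => inner ℂ (twistedAverage hT z N F) G) atTop (𝓝 0) := by
    intro F
    refine tendsto_zero_of_dense_span (fun N => innerSL ℂ (twistedAverage hT z N F))
      (C := 2 * ‖F‖) (fun N G => ?_) hS fun G hG => ?_
    · refine (norm_inner_le_norm (𝕜 := ℂ) _ G).trans ?_
      exact mul_le_mul_of_nonneg_right (norm_twistedAverage_le hT z N F) (norm_nonneg _)
    · have := (Complex.continuous_conj.tendsto 0).comp (h1 G hG F)
      rw [map_zero] at this
      refine this.congr fun N => ?_
      exact inner_conj_symm _ _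
  have h3 : Tendsto (fun N => inner ℂ (hf.toLp f) (twistedAverage hT z N (hf.toLp f))) atTop
      (𝓝 0) := by
    have := (Complex.continuous_conj.tendsto 0).comp (h2 (hf.toLp f) (hf.toLp f))
    rw [map_zero] at this
    exact this.congr fun N => inner_conj_symm _ _
  have h4 := tendsto_average_fourierCoefficient σ z
  -- For `f` of mean zero the inner products in `h3` are the twisted averages of the coefficients of
  -- `σ`, whose limit is the mass of `{z}`.
  have h5 : (σ.real {z} : ℂ) = 0 := by
    refine tendsto_nhds_unique (h4.congr fun N => ?_) h3
    rw [twistedAverage_apply, inner_oneLp, hf0, zero_smul, inner_smul_right, inner_sum]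
    congr 1
    refine Finset.sum_congr rfl fun j _ => ?_
    rw [sub_zero, inner_smul_right, inner_toLp_koopman, hσ.2]
  exact (measureReal_eq_zero_iff).1 (by exact_mod_cast h5)

/-- Rigidity follows from the convergence `U ^ n_k F → F` on a set with dense span. -/
lemma isRigidFor_of_tendsto (hT : ∀ j, MeasurePreserving (iter T j) m m) {n : ℕ → ℤ}
    {S : Set (Lp ℂ 2 m)} (hS : Dense (Submodule.span ℂ S : Set (Lp ℂ 2 m)))
    (h : ∀ F ∈ S, Tendsto (fun k => koopman hT (n k) F - F) atTop (𝓝 0)) :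
    IsRigidFor m T n := by
  intro A hA
  have hall := tendsto_zero_of_dense_span
    (fun k => (koopman hT (n k)).toContinuousLinearMap - ContinuousLinearMap.id ℂ _) (C := 2)
    (fun k F => by
      refine (norm_sub_le _ _).trans ?_
      change ‖koopman hT (n k) F‖ + ‖F‖ ≤ 2 * ‖F‖
      rw [LinearIsometry.norm_map]
      linarith) hS h
    (indicatorConstLp 2 hA (measure_ne_top m A) 1)
  -- The measure of a symmetric difference is the squared `L²` distance of the indicators.
  have hn : ∀ k, m.real (symmDiff (iter T (n k) ⁻¹' A) A) =
      ‖koopman hT (n k) (indicatorConstLp 2 hA (measure_ne_top m A) (1 : ℂ)) -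
        indicatorConstLp 2 hA (measure_ne_top m A) (1 : ℂ)‖ ^ 2 := by
    intro k
    have hpre := (hT (n k)).measurable hA
    have h1 : koopman hT (n k) (indicatorConstLp 2 hA (measure_ne_top m A) (1 : ℂ)) =
        indicatorConstLp 2 hpre (measure_ne_top m _) (1 : ℂ) :=
      (Lp.indicatorConstLp_compMeasurePreserving hA (measure_ne_top m A) 1 (hT (n k)))
    rw [h1, ← dist_eq_norm, dist_indicatorConstLp_eq_norm,
      norm_indicatorConstLp (by simp) (by simp)]
    rw [norm_one, one_mul, ← Real.rpow_natCast, ← Real.rpow_mul measureReal_nonneg]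
    simp
  have hreal : Tendsto (fun k => m.real (symmDiff (iter T (n k) ⁻¹' A) A)) atTop (𝓝 0) := by
    have h2 := hall.norm.pow 2
    rw [norm_zero, zero_pow two_ne_zero] at h2
    exact h2.congr fun k => (hn k).symm
  exact (ENNReal.tendsto_toReal_iff (fun k => measure_ne_top m _) ENNReal.zero_ne_top).1 hreal

end Koopman

/-! ### The Gaussian shift is weakly mixing, rigid and nontrivial -/

section Shift

/-- The shift of the infinite torus. -/
def torusShift : (ℤ → Circle) ≃ᵐ (ℤ → Circle) where
  toFun x i := x (i + 1)
  invFun x i := x (i - 1)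
  left_inv x := by funext i; simp
  right_inv x := by funext i; simp
  measurable_toFun := measurable_pi_lambda _ fun i => measurable_pi_apply (i + 1)
  measurable_invFun := measurable_pi_lambda _ fun i => measurable_pi_apply (i - 1)

lemma iter_torusShift (j : ℤ) (x : ℤ → Circle) (i : ℤ) : iter torusShift j x i = x (i + j) := by
  have h1 : ∀ (y : ℤ → Circle) i, iter torusShift 1 y i = y (i + 1) := fun y i => by
    simp only [iter, zpow_one]; rfl
  induction j using Int.induction_on generalizing x i with
  | zero => simp [iter]
  | succ j ih => rw [iter_add, ih, h1, add_assoc]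
  | pred j ih =>
    have h2 := h1 (iter torusShift (-(j : ℤ) - 1) x) (i - 1)
    rw [← iter_add, add_sub_cancel, sub_add_cancel, ih] at h2
    rw [← h2]
    congr 1
    ring

/-- The translate of a multi-index. -/
noncomputable def translate (j : ℤ) (p : ℤ →₀ ℤ) : ℤ →₀ ℤ := p.mapDomain (· + j)

lemma torusChar_iter (j : ℤ) (p : ℤ →₀ ℤ) (x : ℤ → Circle) :
    torusChar p (iter torusShift j x) = torusChar (translate j p) x := by
  unfold torusChar translate
  rw [Finsupp.prod_mapDomain_index (fun _ => zpow_zero _) fun _ _ _ => zpow_add _ _ _]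
  simp only [iter_torusShift]

/-- On the spectral side the shift is multiplication by `z ^ j`. As this has modulus `1`, the
variances defining the Gaussian measure are shift invariant. -/
lemma trigPoly_translate (j : ℤ) (p : ℤ →₀ ℤ) (z : Circle) :
    trigPoly (translate j p) z = ((z ^ j : Circle) : ℂ) * trigPoly p z := by
  unfold trigPoly translate
  rw [Finsupp.sum_mapDomain_index (by simp) (by intros; push_cast; ring), Finsupp.mul_sum]
  refine Finsupp.sum_congr fun i _ => ?_
  rw [zpow_add, Circle.coe_mul]
  ring

variable {σ : ProbabilityMeasure Circle} {m : ProbabilityMeasure (ℤ → Circle)}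

lemma continuous_iter_torusShift (j : ℤ) : Continuous (iter torusShift j) :=
  continuous_pi fun i => by
    simp only [iter_torusShift]
    exact continuous_apply _

lemma IsGaussianTorusMeasure.measurePreserving_iter (hm : IsGaussianTorusMeasure σ m) (j : ℤ) :
    MeasurePreserving (iter torusShift j) (m : Measure (ℤ → Circle)) m := by
  have hmeas := (continuous_iter_torusShift j).measurable
  refine ⟨hmeas, ?_⟩
  have h : m.map hmeas.aemeasurable = m := by
    refine eq_of_integral_torusChar_eq fun p => ?_
    refine (integral_map hmeas.aemeasurable (continuous_circle_coe.comp
      (continuous_torusChar p)).aestronglyMeasurable).trans ?_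
    simp only [Function.comp_apply, torusChar_iter]
    rw [hm, hm]
    simp only [trigPoly_translate, norm_mul, Circle.norm_coe, one_mul]
  exact congrArg ProbabilityMeasure.toMeasure h

/-- The characters of the infinite torus as elements of `L²`. -/
noncomputable def torusCharLp (m : ProbabilityMeasure (ℤ → Circle)) (p : ℤ →₀ ℤ) :
    Lp ℂ 2 (m : Measure (ℤ → Circle)) :=
  ContinuousMap.toLp 2 (m : Measure (ℤ → Circle)) ℂ (torusCharMap p)

lemma dense_span_torusCharLp :
    Dense (Submodule.span ℂ (Set.range (torusCharLp m)) :
      Set (Lp ℂ 2 (m : Measure (ℤ → Circle)))) := by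
  have h := (ContinuousMap.toLp_denseRange ℂ (m : Measure (ℤ → Circle)) ℂ
    (p := 2) (by simp)).dense_image (ContinuousMap.toLp 2 (m : Measure (ℤ → Circle)) ℂ).continuous
    dense_span_torusCharMap
  refine h.mono ?_
  rintro _ ⟨f, hf, rfl⟩
  have h2 : ContinuousMap.toLp 2 (m : Measure (ℤ → Circle)) ℂ f ∈ Submodule.map
      (ContinuousMap.toLp 2 (m : Measure (ℤ → Circle)) ℂ).toLinearMap
      (Submodule.span ℂ (Set.range torusCharMap)) := ⟨f, hf, rfl⟩
  rw [Submodule.map_span, ← Set.range_comp] at h2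
  exact h2

/-- The Fourier coefficients of the Gaussian measure with spectral measure `σ`. -/
noncomputable def gaussianCoeff (σ : ProbabilityMeasure Circle) (p : ℤ →₀ ℤ) : ℝ :=
  Real.exp (-(1 / 2) * ∫ z, ‖trigPoly p z‖ ^ 2 ∂(σ : Measure Circle))

lemma inner_torusCharLp (hm : IsGaussianTorusMeasure σ m) (p q : ℤ →₀ ℤ) :
    inner ℂ (torusCharLp m q) (torusCharLp m p) = (gaussianCoeff σ (p - q) : ℂ) := by
  refine Eq.trans ?_ (hm (p - q))
  rw [torusCharLp, torusCharLp, ContinuousMap.inner_toLp]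
  refine integral_congr_ae (ae_of_all _ fun x => ?_)
  simp only [torusCharMap_apply]
  rw [sub_eq_add_neg, torusChar_add, torusChar_neg, Circle.coe_mul, Circle.coe_inv_eq_conj]

lemma koopman_torusCharLp (hm : IsGaussianTorusMeasure σ m) (j : ℤ) (p : ℤ →₀ ℤ) :
    koopman hm.measurePreserving_iter j (torusCharLp m p) = torusCharLp m (translate j p) := by
  apply Lp.ext
  refine (coeFn_koopman _ _ _).trans ?_
  refine (((hm.measurePreserving_iter j).quasiMeasurePreserving.ae_eq_comp
    (ContinuousMap.coeFn_toLp _ (torusCharMap p))).trans ?_).trans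
      (ContinuousMap.coeFn_toLp _ (torusCharMap (translate j p))).symm
  exact ae_of_all _ fun x => by simp [torusChar_iter]

lemma oneLp_eq_torusCharLp : oneLp (m : Measure (ℤ → Circle)) = torusCharLp m 0 := by
  apply Lp.ext
  refine (MemLp.coeFn_toLp _).trans ?_
  refine EventuallyEq.trans ?_ (ContinuousMap.coeFn_toLp _ (torusCharMap 0)).symm
  exact ae_of_all _ fun x => by simp [torusChar_zero]

lemma abs_exp_neg_sub_exp_neg_le {a b : ℝ} (ha : 0 ≤ a) (hb : 0 ≤ b) :
    |Real.exp (-a) - Real.exp (-b)| ≤ |a - b| := by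
  wlog h : a ≤ b generalizing a b
  · rw [abs_sub_comm, abs_sub_comm a]
    exact this hb ha (le_of_not_ge h)
  have h1 : Real.exp (-b) = Real.exp (-a) * Real.exp (a - b) := by
    rw [← Real.exp_add]; ring_nf
  have h2 : Real.exp (-a) ≤ 1 := Real.exp_le_one_iff.2 (by linarith)
  have h3 : a - b + 1 ≤ Real.exp (a - b) := Real.add_one_le_exp _
  have h4 : Real.exp (a - b) ≤ 1 := Real.exp_le_one_iff.2 (by linarith)
  rw [abs_of_nonneg (sub_nonneg.2 (Real.exp_le_exp.2 (by linarith))),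
    abs_of_nonpos (by linarith : a - b ≤ 0), h1]
  nlinarith [Real.exp_pos (-a)]

/-- Correlations of characters decorrelate at the speed of the Fourier coefficients of a measure
absolutely continuous with respect to `σ`. -/
lemma abs_gaussianCoeff_sub_le (σ : ProbabilityMeasure Circle) (p q : ℤ →₀ ℤ) (j : ℤ) :
    |gaussianCoeff σ (translate j p - q) - gaussianCoeff σ p * gaussianCoeff σ q| ≤
      ‖∫ z, ((z ^ j : Circle) : ℂ) * (trigPoly p z * (starRingEnd ℂ) (trigPoly q z))
        ∂(σ : Measure Circle)‖ := by
  have hnn : ∀ r : ℤ →₀ ℤ, 0 ≤ ∫ z, ‖trigPoly r z‖ ^ 2 ∂(σ : Measure Circle) := fun r =>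
    integral_nonneg fun z => by positivity
  have hi : ∀ r : ℤ →₀ ℤ, Integrable (fun z => ‖trigPoly r z‖ ^ 2) (σ : Measure Circle) := fun r =>
    integrable_of_continuous ((continuous_trigPoly r).norm.pow 2) _
  have hint : Integrable (fun z => ((z ^ j : Circle) : ℂ) *
      (trigPoly p z * (starRingEnd ℂ) (trigPoly q z))) (σ : Measure Circle) :=
    integrable_of_continuous ((continuous_coe_zpow j).mul ((continuous_trigPoly p).mul
      (Complex.continuous_conj.comp (continuous_trigPoly q)))) _
  have hre : ∫ z, (((z ^ j : Circle) : ℂ) *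
      (trigPoly p z * (starRingEnd ℂ) (trigPoly q z))).re ∂(σ : Measure Circle) =
      (∫ z, ((z ^ j : Circle) : ℂ) * (trigPoly p z * (starRingEnd ℂ) (trigPoly q z))
        ∂(σ : Measure Circle)).re := integral_re hint
  -- Up to the cross term `2 Re ∫ z ^ j P Q̄ dσ` the variances add; the `½` in the exponent cancels
  -- the `2`, and `exp(-t)` is 1-Lipschitz for `t ≥ 0`.
  have hexpand : ∫ z, ‖trigPoly (translate j p - q) z‖ ^ 2 ∂(σ : Measure Circle) =
      (∫ z, ‖trigPoly p z‖ ^ 2 ∂(σ : Measure Circle) +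
        ∫ z, ‖trigPoly q z‖ ^ 2 ∂(σ : Measure Circle)) -
        2 * (∫ z, ((z ^ j : Circle) : ℂ) * (trigPoly p z * (starRingEnd ℂ) (trigPoly q z))
        ∂(σ : Measure Circle)).re := by
    rw [← hre, ← integral_const_mul, ← integral_add (hi p) (hi q)]
    refine Eq.trans ?_ (integral_sub ((hi p).add (hi q)) (hint.re.const_mul 2))
    refine integral_congr_ae (ae_of_all _ fun z => ?_)
    simp only [sub_eq_add_neg, trigPoly_add, trigPoly_neg, trigPoly_translate]
    rw [← sub_eq_add_neg, ← Complex.normSq_eq_norm_sq, Complex.normSq_sub, Complex.normSq_mul,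
      Circle.normSq_coe, one_mul, Complex.normSq_eq_norm_sq, Complex.normSq_eq_norm_sq, mul_assoc]
    rfl
  have hprod : gaussianCoeff σ p * gaussianCoeff σ q = Real.exp (-(1 / 2 *
      (∫ z, ‖trigPoly p z‖ ^ 2 ∂(σ : Measure Circle) +
        ∫ z, ‖trigPoly q z‖ ^ 2 ∂(σ : Measure Circle)))) := by
    rw [gaussianCoeff, gaussianCoeff, ← Real.exp_add]
    ring_nf
  rw [hprod, gaussianCoeff, neg_mul]
  refine (abs_exp_neg_sub_exp_neg_le (mul_nonneg (by norm_num) (hnn _))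
    (mul_nonneg (by norm_num) (add_nonneg (hnn p) (hnn q)))).trans ?_
  rw [hexpand]
  refine le_trans (le_of_eq ?_) (Complex.abs_re_le_norm _)
  rw [← abs_neg]
  ring_nf

/-- It suffices to test characters. Taking norms removes the twist by `z`, and what remains is
dominated by the averages of `|∫ z ^ j P Q̄ dσ|` in Wiener's lemma. -/
lemma IsGaussianTorusMeasure.isWeaklyMixing (hm : IsGaussianTorusMeasure σ m)
    (hc : ∀ z : Circle, (σ : Measure Circle) {z} = 0) :
    IsWeaklyMixing (m : Measure (ℤ → Circle)) torusShift := by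
  refine isWeaklyMixing_of_tendsto hm.measurePreserving_iter dense_span_torusCharLp ?_
  rintro z _ ⟨p, rfl⟩ _ ⟨q, rfl⟩
  have hW := tendsto_average_norm_integral (σ : Measure Circle) hc
    ((continuous_trigPoly p).mul (Complex.continuous_conj.comp (continuous_trigPoly q)))
  refine squeeze_zero_norm (fun N => ?_) hW
  rw [twistedAverage_apply, inner_smul_right, inner_sum, norm_mul, norm_inv, Complex.norm_natCast]
  refine mul_le_mul_of_nonneg_left ((norm_sum_le _ _).trans (Finset.sum_le_sum fun j _ => ?_))
    (by positivity)
  rw [inner_smul_right, norm_mul, Circle.norm_coe, one_mul, inner_sub_right, inner_smul_right,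
    koopman_torusCharLp hm, oneLp_eq_torusCharLp, inner_torusCharLp hm, inner_torusCharLp hm,
    inner_torusCharLp hm, sub_zero, zero_sub, ← Complex.ofReal_mul, ← Complex.ofReal_sub,
    Complex.norm_real, Real.norm_eq_abs]
  have hneg : gaussianCoeff σ (-q) = gaussianCoeff σ q := by
    simp only [gaussianCoeff, trigPoly_neg, norm_neg]
  rw [hneg]
  exact abs_gaussianCoeff_sub_le σ p q j

/-- For a character the squared distance is `2 - 2 exp(-½ ∫ |z ^ n_k - 1|² |P|² dσ)`. It tends to
`0` because `P` is bounded and `z ^ n_k → 1` in `L²(σ)`. -/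
lemma IsGaussianTorusMeasure.isRigidFor (hm : IsGaussianTorusMeasure σ m) {n : ℕ → ℤ}
    (hσ : σ ∈ rigidMeasures n) : IsRigidFor (m : Measure (ℤ → Circle)) torusShift n := by
  refine isRigidFor_of_tendsto hm.measurePreserving_iter dense_span_torusCharLp ?_
  rintro _ ⟨p, rfl⟩
  obtain ⟨C, hC⟩ := (isCompact_range (continuous_trigPoly p)).isBounded.exists_norm_le
  have hexp : Tendsto (fun k => ∫ z, ‖trigPoly (translate (n k) p - p) z‖ ^ 2
      ∂(σ : Measure Circle)) atTop (𝓝 0) := by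
    have h1 := (tendsto_integral_normSq_sub_one hσ).mul_const (C ^ 2)
    rw [zero_mul] at h1
    refine squeeze_zero (fun k => integral_nonneg fun z => by positivity) (fun k => ?_) h1
    rw [← integral_mul_const]
    have hcont : Continuous fun z : Circle => ‖((z ^ n k : Circle) : ℂ) - 1‖ ^ 2 * C ^ 2 :=
      ((((continuous_coe_zpow _).sub continuous_const).norm).pow 2).mul continuous_const
    refine integral_mono (integrable_of_continuous ((continuous_trigPoly _).norm.pow 2) _)
      (integrable_of_continuous hcont _) fun z => ?_
    have h2 : trigPoly (translate (n k) p - p) z =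
        (((z ^ n k : Circle) : ℂ) - 1) * trigPoly p z := by
      rw [sub_eq_add_neg, trigPoly_add, trigPoly_neg, trigPoly_translate]
      ring
    simp only [h2, norm_mul, mul_pow]
    gcongr
    exact hC _ ⟨z, rfl⟩
  have hg : Tendsto (fun k => 2 - 2 * gaussianCoeff σ (translate (n k) p - p)) atTop (𝓝 0) := by
    have h1 := ((Real.continuous_exp.tendsto _).comp (hexp.const_mul (-(1 / 2)))).const_mul 2
      |>.const_sub 2
    rw [mul_zero, Real.exp_zero, mul_one, sub_self] at h1
    exact h1
  have hnorm : ∀ k, ‖koopman hm.measurePreserving_iter (n k) (torusCharLp m p) - torusCharLp m p‖ =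
      √(2 - 2 * gaussianCoeff σ (translate (n k) p - p)) := by
    intro k
    have hone : ‖torusCharLp m p‖ ^ 2 = 1 := by
      have h1 := inner_self_eq_norm_sq_to_K (𝕜 := ℂ) (torusCharLp m p)
      rw [inner_torusCharLp hm, sub_self] at h1
      have h2 : gaussianCoeff σ 0 = 1 := by simp [gaussianCoeff, trigPoly]
      rw [h2] at h1
      rw [Complex.ofReal_one] at h1
      exact Complex.ofReal_injective (by rw [Complex.ofReal_one, h1]; simp)
    have hk : ‖koopman hm.measurePreserving_iter (n k) (torusCharLp m p)‖ ^ 2 = 1 := by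
      rw [LinearIsometry.norm_map, hone]
    rw [← Real.sqrt_sq (norm_nonneg (koopman hm.measurePreserving_iter (n k) (torusCharLp m p) -
      torusCharLp m p)), norm_sub_rev, @norm_sub_sq ℂ, hone, hk, koopman_torusCharLp hm,
      inner_torusCharLp hm, RCLike.re_to_complex, Complex.ofReal_re]
    ring_nf
  rw [tendsto_zero_iff_norm_tendsto_zero]
  simp_rw [hnorm]
  simpa using hg.sqrt

/-- A zero-one measure here would be a Dirac mass, with all coefficients of modulus `1`; a
coordinate character has coefficient `exp(-½)`. -/
lemma IsGaussianTorusMeasure.exists_nontrivial_set (hm : IsGaussianTorusMeasure σ m) :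
    ∃ A : Set (ℤ → Circle), MeasurableSet A ∧ (m : Measure (ℤ → Circle)) A ≠ 0 ∧
      (m : Measure (ℤ → Circle)) A ≠ 1 := by
  by_contra! hA
  have : IsZeroOneMeasure (m : Measure (ℤ → Circle)) :=
    ⟨fun A hA' => or_iff_not_imp_left.2 (hA A hA')⟩
  obtain ⟨x₀, hx₀⟩ := IsZeroOneMeasure.exists_eq_dirac (μ := (m : Measure (ℤ → Circle)))
  have h := congrArg norm (hm (Finsupp.single 0 1))
  rw [hx₀, integral_dirac, Circle.norm_coe, Complex.norm_real, Real.norm_eq_abs, Real.abs_exp] at h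
  simp only [trigPoly, Int.cast_zero, zero_mul, Finsupp.sum_single_index, Int.cast_one, one_mul,
    Circle.norm_coe, one_pow, integral_const, probReal_univ, smul_eq_mul, mul_one] at h
  exact (Real.exp_lt_one_iff.2 (by norm_num : -(1 / 2 : ℝ) < 0)).ne h.symm

end Shift

/-! ### Passing between systems and atomless rigid measures -/

lemma isRigiditySequence_of_atomless {n : ℕ → ℤ} {σ : ProbabilityMeasure Circle}
    (hσ : σ ∈ rigidMeasures n) (hc : ∀ z : Circle, (σ : Measure Circle) {z} = 0) :
    IsRigiditySequence n := by
  obtain ⟨m, hm⟩ := exists_gaussianTorusMeasure σ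
  refine ⟨ℤ → Circle, inferInstance, m, torusShift, inferInstance, hm.exists_nontrivial_set, ?_,
    hm.isWeaklyMixing hc, hm.isRigidFor hσ⟩
  have h := hm.measurePreserving_iter 1
  rwa [show iter torusShift 1 = torusShift by simp [iter]] at h

lemma measurable_iter {X : Type*} [MeasurableSpace X] (T : X ≃ᵐ X) (j : ℤ) :
    Measurable (iter T j) := by
  induction j using Int.induction_on with
  | zero => simpa [iter] using measurable_id
  | succ j ih =>
    have h : iter T ((j : ℤ) + 1) = iter T j ∘ T := by
      funext x
      rw [iter_add]
      simp [iter]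
    rw [h]
    exact ih.comp T.measurable
  | pred j ih =>
    have h : iter T (-(j : ℤ) - 1) = iter T (-j) ∘ T.symm := by
      funext x
      rw [sub_eq_add_neg, iter_add]
      simp [iter]
    rw [h]
    exact ih.comp T.symm.measurable

/-- The measure is the normalised spectral measure of `f = 1_A - m(A)`. Since `|f ∘ T ^ n_k - f|` is
the indicator of `T ^ (-n_k) A ∆ A`, rigidity forces its coefficients to tend to the total mass. -/
lemma exists_atomless_of_isRigiditySequence {n : ℕ → ℤ} (h : IsRigiditySequence n) :
    ∃ σ ∈ rigidMeasures n, ∀ z : Circle, (σ : Measure Circle) {z} = 0 := by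
  obtain ⟨X, _, m, T, _, ⟨A, hA, hA0, hA1⟩, hT, hmix, hrig⟩ := h
  set c : ℝ := m.real A with hc
  have hc0 : 0 ≤ c := measureReal_nonneg
  have hc1 : c ≤ 1 := measureReal_le_one
  let f : X → ℂ := fun x => A.indicator (fun _ => (1 : ℂ)) x - c
  have hfm : Measurable f := (measurable_const.indicator hA).sub measurable_const
  have hind : Integrable (A.indicator fun _ => (1 : ℂ)) m := (integrable_const _).indicator hA
  have hfb : ∀ x, ‖f x‖ ≤ 1 := by
    intro x
    by_cases hx : x ∈ A
    · simp only [f, Set.indicator_of_mem hx]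
      rw [← Complex.ofReal_one, ← Complex.ofReal_sub, Complex.norm_real, Real.norm_eq_abs,
        abs_le]
      constructor <;> linarith
    · simp only [f, Set.indicator_of_notMem hx]
      rw [zero_sub, norm_neg, Complex.norm_real, Real.norm_eq_abs, abs_le]
      constructor <;> linarith
  have hf2 : MemLp f 2 m := MemLp.of_bound hfm.aestronglyMeasurable 1 (ae_of_all _ hfb)
  have hf0 : ∫ x, f x ∂m = 0 := by
    have h1 : ∫ x, f x ∂m = ∫ x, A.indicator (fun _ => (1 : ℂ)) x ∂m - ∫ _, (c : ℂ) ∂m :=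
      integral_sub hind (integrable_const _)
    rw [h1, integral_indicator hA]
    simp [hc, Measure.real]
  obtain ⟨σ, ⟨hσfin, hσ⟩, hatom⟩ := hmix f hf2 hf0
  have hint : ∀ j, Integrable (fun x => f (iter T j x) * (starRingEnd ℂ) (f x)) m := fun j =>
    Integrable.of_bound ((hfm.comp (measurable_iter T j)).mul
      (Complex.continuous_conj.measurable.comp hfm)).aestronglyMeasurable 1
      (ae_of_all _ fun x => by
        rw [norm_mul, RCLike.norm_conj]
        exact mul_le_one₀ (hfb _) (norm_nonneg _) (hfb _))
  have hlim : Tendsto (fun k => fourierCoefficient σ (n k)) atTop (𝓝 (fourierCoefficient σ 0)) := by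
    have hm0 : Tendsto (fun k => m.real (symmDiff (iter T (n k) ⁻¹' A) A)) atTop (𝓝 0) :=
      (ENNReal.tendsto_toReal_iff (fun k => measure_ne_top m _) ENNReal.zero_ne_top).2 (hrig A hA)
    rw [tendsto_iff_norm_sub_tendsto_zero]
    refine squeeze_zero (fun _ => norm_nonneg _) (fun k => ?_) hm0
    have hS : MeasurableSet (symmDiff (iter T (n k) ⁻¹' A) A) :=
      (measurable_iter T (n k) hA).symmDiff hA
    rw [hσ, hσ, ← integral_sub (hint _) (hint _), ← integral_indicator_one hS]
    refine norm_integral_le_of_norm_le ((integrable_const (1 : ℝ)).indicator hS)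
      (ae_of_all _ fun x => ?_)
    rw [← sub_mul, norm_mul, RCLike.norm_conj]
    have h0 : iter T 0 x = x := by simp [iter]
    rw [h0]
    refine (mul_le_of_le_one_right (norm_nonneg _) (hfb x)).trans ?_
    simp only [f, sub_sub_sub_cancel_right]
    by_cases h1 : iter T (n k) x ∈ A <;> by_cases h2 : x ∈ A <;>
      simp [Set.indicator, Set.mem_symmDiff, h1, h2]
  have hmass : fourierCoefficient σ 0 = (σ.real Set.univ : ℂ) := by simp [fourierCoefficient]
  -- The total mass is `‖f‖²`. If it vanished, `f` would be zero somewhere on `A`, where it equals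
  -- `1 - m(A)`, which is nonzero.
  have hne : σ Set.univ ≠ 0 := by
    intro h0
    have h1 : ∫ x, ‖f x‖ ^ 2 ∂m = 0 := by
      have h2 := hσ 0
      rw [hmass, Measure.real, h0, ENNReal.toReal_zero, Complex.ofReal_zero] at h2
      have h3 : ∀ x, f (iter T 0 x) * (starRingEnd ℂ) (f x) = ((‖f x‖ ^ 2 : ℝ) : ℂ) := by
        intro x
        have h0 : iter T 0 x = x := by simp [iter]
        rw [h0, Complex.mul_conj, Complex.normSq_eq_norm_sq]
      simp_rw [h3] at h2
      rw [integral_complex_ofReal] at h2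
      exact_mod_cast h2.symm
    have h4 : Integrable (fun x => ‖f x‖ ^ 2) m :=
      Integrable.of_bound (hfm.norm.pow_const 2).aestronglyMeasurable 1 (ae_of_all _ fun x => by
        rw [norm_pow, norm_norm]
        exact pow_le_one₀ (norm_nonneg _) (hfb x))
    have h5 := (integral_eq_zero_iff_of_nonneg (fun x => by positivity) h4).1 h1
    obtain ⟨x, hx, hxA⟩ := (h5.and_frequently (frequently_ae_mem_iff.2 hA0)).exists
    have h6 : f x = 0 := by simpa using hx
    simp only [f, Set.indicator_of_mem hxA] at h6
    have h7 : c = 1 := by exact_mod_cast (sub_eq_zero.1 h6).symm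
    refine hA1 ?_
    rw [← ofReal_measureReal (μ := m) (s := A), ← hc, h7, ENNReal.ofReal_one]
  refine ⟨⟨(σ Set.univ)⁻¹ • σ, ⟨?_⟩⟩, ?_, fun z => ?_⟩
  · rw [Measure.smul_apply, smul_eq_mul, ENNReal.inv_mul_cancel hne (measure_ne_top _ _)]
  · change Tendsto (fun k => fourierCoefficient ((σ Set.univ)⁻¹ • σ) (n k)) atTop (𝓝 1)
    have h1 : ∀ j, fourierCoefficient ((σ Set.univ)⁻¹ • σ) j =
        ((σ.real Set.univ)⁻¹ : ℂ) * fourierCoefficient σ j := by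
      intro j
      simp only [fourierCoefficient]
      rw [integral_smul_measure, ENNReal.toReal_inv, Complex.real_smul, Complex.ofReal_inv]
      rfl
    simp_rw [h1]
    have h2 := hlim.const_mul ((σ.real Set.univ)⁻¹ : ℂ)
    rw [hmass] at h2
    have h3 : (σ.real Set.univ : ℂ) ≠ 0 := by
      rw [Complex.ofReal_ne_zero]
      exact (ENNReal.toReal_pos hne (measure_ne_top _ _)).ne'
    rwa [inv_mul_cancel₀ h3] at h2
  · change ((σ Set.univ)⁻¹ • σ) {z} = 0
    rw [Measure.smul_apply, hatom, smul_zero]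

end RigiditySeq

theorem mainTheorem8 (n : ℕ → ℤ) :
    (RigiditySeq.IsRigiditySequence n ↔
      ∀ ε : ℝ, 0 < ε → Dense (RigiditySeq.almostRigidMeasures n ε)) ∧
    ((∀ ε : ℝ, 0 < ε → Dense (RigiditySeq.almostRigidPoints n ε)) →
      RigiditySeq.IsRigiditySequence n) := by
  have hback : (∀ ε : ℝ, 0 < ε → Dense (RigiditySeq.almostRigidMeasures n ε)) →
      RigiditySeq.IsRigiditySequence n := fun hd => by
    obtain ⟨σ, hσ, hc⟩ := RigiditySeq.exists_atomless_rigid hd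
    exact RigiditySeq.isRigiditySequence_of_atomless hσ hc
  refine ⟨⟨fun h ε hε => ?_, hback⟩, fun h => hback fun ε hε =>
    RigiditySeq.dense_almostRigidMeasures_of_dense_points (h ε hε)⟩
  obtain ⟨σ, hσ, hc⟩ := RigiditySeq.exists_atomless_of_isRigiditySequence h
  exact RigiditySeq.dense_almostRigidMeasures_of_atomless hσ hc hε
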